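/- Notation. Let $N\ge 1$. Partitions $\lambda,\mu$ have length $\le N$; $\lambda'$ is the conjugate of $\lambda$, $(a^b)$ is the partition with $b$ parts equal to $a$, and partitions are added part by part. $s_{\kappa/\lambda}$ is the skew Schur polynomial (the generating function of semistandard tableaux of shape $\kappa/\lambda$, equal to $0$ if $\lambda\not\subseteq\kappa$), $s_\lambda=s_{\lambda/\varnothing}$, $(\kappa/\lambda)'=\kappa'/\lambda'$, $s(1^n)$ is the value of the $n$-variable polynomial $s$ at $(1,\dots,1)$, and $e_k$ is the $k$-th elementary symmetric polynomial. For a function $f$ on the unit circle with Fourier coefficients $d_n=\frac1{2\pi}\int_{-\pi}^{\pi}f(e^{i\theta})e^{-in\theta}\,d\theta$ put $$D_N^{\lambda,\mu}(f)=\det\left(d_{j-\lambda_j-k+\mu_k}\right)_{j,k=1}^N .$$ For positive integers $\gamma,\delta$ let $\varphi_{\gamma,\delta}(z)=(1+z)^\gamma(1+z^{-1})^\delta$. For real $\gamma,\delta>0$ and polynomials $P,Q$ in $N$ variables let $$I_N^{\gamma,\delta}(P,Q)=\frac1{N!\,(2\pi)^N}\int_{(-\pi,\pi)^N}P(e^{i\theta_1},\dots,e^{i\theta_N})\,Q(e^{-i\theta_1},\dots,e^{-i\theta_N})\prod_{j=1}^N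 e^{\frac12 i\theta_j(\gamma-\delta)}|1+e^{i\theta_j}|^{\gamma+\delta}\prod_{1\le j<k\le N}|e^{i\theta_j}-e^{i\theta_k}|^2\,d\theta_1\cdots d\theta_N$$ (the Morris integral with insertions $P,Q$). For integers $0\le j,k\le N$ and real $M,d$ let $$R_{N}^{j,k}(M,d)=G(N+2)\frac{G(M+N+2)}{G(M+1)}\frac{G(M-d+1)}{G(M-d+N+2)}\frac{G(d+1)}{G(d+N+2)}\,\frac{\Gamma(M-d+j+1)}{\Gamma(j+1)}\frac{\Gamma(d+k+1)}{\Gamma(k+1)}\sum_{r=\max(j,k)}^{N}\frac{\Gamma(r+1)}{\Gamma(M+r+1)}\binom{M-d+r-k-1}{r-k}\binom{d+r-j-1}{r-j},$$ where $G$ is the Barnes $G$-function and $\binom{x}{n}=x(x-1)\cdots(x-n+1)/n!$. Theorem. Let $N\ge1$. (1) For all positive integers $\gamma,\delta$ and all partitions $\lambda,\mu$ of length at most $N$, $$I_N^{\gamma,\delta}(s_\lambda,s_\mu)=D_N^{\lambda,\mu}(\varphi_{\gamma,\delta})=s_{((\delta^N)+\mu/\lambda)'}(1^{\gamma+\delta}).$$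 (2) For $0\le k\le N$, $s_{(1^k)}=e_k$ in $N$ variables. (3) For all integers $0\le j,k\le N$ and $0\le d\le M$ such that $M>d$ or $j=0$, $$s_{(\underbrace{N,\dots,N}_{d},\,j)/(k)}(1^M)=R_N^{j,k}(M,d).$$ (4) For all integers $0\le j,k\le N$ and all real $\gamma,\delta>0$, $$I_N^{\gamma,\delta}(e_k,e_j)=R_N^{j,k}(\gamma+\delta,\delta),$$ that is, the Morris integral with $s_\lambda=e_k$, $s_\mu=e_j$ has the explicit value obtained from (3) by replacing $M-d$ by $\gamma$ and $d$ by $\delta$. -/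

import Mathlib

open scoped Real

noncomputable section

/-! ### Partitions

Partitions are Young diagrams: `mu.rowLen i` is the part `μ_{i+1}`, `mu.colLen 0` is the length
`l(μ)`, and `mu.transpose` is the conjugate partition. -/

/-- The partition `(a^b)` with `b` parts equal to `a`. -/
def rectPartition (a b : ℕ) : YoungDiagram where
  cells := Finset.range b ×ˢ Finset.range a
  isLowerSet := by
    rintro ⟨i, j⟩ ⟨i', j'⟩ ⟨h1, h2⟩ h
    simp only [Finset.coe_product, Finset.coe_range, Set.mem_prod, Set.mem_Iio] at h ⊢
    exact ⟨lt_of_le_of_lt h1 h.1, lt_of_le_of_lt h2 h.2⟩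

theorem mem_rectPartition {a b i j : ℕ} : (i, j) ∈ rectPartition a b ↔ i < b ∧ j < a := by
  rw [← YoungDiagram.mem_cells]
  simp [rectPartition]

/-- The partwise sum `α + β` of two partitions, with parts `α_i + β_i`. -/
def addPartition (α β : YoungDiagram) : YoungDiagram where
  cells := (Finset.range (max (α.colLen 0) (β.colLen 0)) ×ˢ
    Finset.range (α.rowLen 0 + β.rowLen 0)).filter fun c => c.2 < α.rowLen c.1 + β.rowLen c.1
  isLowerSet := by
    rintro ⟨i, j⟩ ⟨i', j'⟩ ⟨h1, h2⟩ h
    simp only [Finset.coe_filter, Finset.mem_product, Finset.mem_range, Set.mem_ofPred_eq] at h ⊢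
    simp only at h1 h2
    have ha := α.rowLen_anti i' i h1
    have hb := β.rowLen_anti i' i h1
    omega

theorem mem_addPartition {α β : YoungDiagram} {i j : ℕ} :
    (i, j) ∈ addPartition α β ↔ j < α.rowLen i + β.rowLen i := by
  rw [← YoungDiagram.mem_cells]
  simp only [addPartition, Finset.mem_filter, Finset.mem_product, Finset.mem_range]
  refine ⟨fun h => h.2, fun h => ⟨⟨?_, ?_⟩, h⟩⟩
  · rw [lt_max_iff, ← YoungDiagram.mem_iff_lt_colLen, ← YoungDiagram.mem_iff_lt_colLen,
      YoungDiagram.mem_iff_lt_rowLen, YoungDiagram.mem_iff_lt_rowLen]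
    omega
  · have ha := α.rowLen_anti 0 i (Nat.zero_le i)
    have hb := β.rowLen_anti 0 i (Nat.zero_le i)
    omega

theorem rowLen_addPartition (α β : YoungDiagram) (i : ℕ) :
    (addPartition α β).rowLen i = α.rowLen i + β.rowLen i :=
  eq_of_forall_lt_iff fun j => by
    rw [← YoungDiagram.mem_iff_lt_rowLen, mem_addPartition]

/-- The partition `(N, …, N, j)` with `d` parts `N` followed by one part `j ≤ N`. -/
def rectWithRow (N d j : ℕ) (h : j ≤ N) : YoungDiagram :=
  YoungDiagram.ofRowLens (List.replicate d N ++ [j]) (by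
    rw [List.sortedGE_iff_pairwise, List.pairwise_append]
    refine ⟨List.pairwise_replicate.2 (Or.inr le_rfl), List.pairwise_singleton _ _, ?_⟩
    intro a ha b hb
    rw [List.eq_of_mem_replicate ha, List.mem_singleton.1 hb]
    exact h)

/-! ### Schur and skew Schur polynomials -/

/-- The semistandard fillings of the skew diagram `ka / la` with entries in `{0, …, n - 1}`: weakly
increasing along rows and strictly increasing down columns. A cell `(a, b)` lies in row `a` and
column `b`. -/
def skewTableaux (ka la : YoungDiagram) (n : ℕ) :
    Set ({c : ℕ × ℕ // c ∈ ka.cells \ la.cells} → Fin n) :=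
  {T | (∀ c c', c.1.1 = c'.1.1 → c.1.2 < c'.1.2 → T c ≤ T c') ∧
    (∀ c c', c.1.2 = c'.1.2 → c.1.1 < c'.1.1 → T c < T c')}

open scoped Classical in
/-- The skew Schur polynomial `s_{ka/la}(x_1, …, x_n)`, the generating function of semistandard
tableaux of shape `ka / la`; it is zero if `la` is not contained in `ka`. -/
def skewSchur (R : Type*) [CommRing R] (ka la : YoungDiagram) (n : ℕ) : MvPolynomial (Fin n) R :=
  if la ≤ ka then
    ∑ T : {c : ℕ × ℕ // c ∈ ka.cells \ la.cells} → Fin n with T ∈ skewTableaux ka la n,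
      ∏ c, MvPolynomial.X (T c)
  else 0

/-- The Schur polynomial `s_la(x_1, …, x_n)`. -/
def schur (R : Type*) [CommRing R] (la : YoungDiagram) (n : ℕ) : MvPolynomial (Fin n) R :=
  skewSchur R la ⊥ n

/-- The value of a polynomial at `(1, …, 1)`. -/
def evalOnes {R : Type*} [CommRing R] {n : ℕ} (P : MvPolynomial (Fin n) R) : R :=
  MvPolynomial.eval (fun _ => 1) P

/-! ### Toeplitz minors -/

/-- The Fourier coefficient `d_n = (2π)⁻¹ ∫ f(e^{iθ}) e^{-inθ} dθ` of a function on the unit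
circle. -/
def circleCoeff (f : Circle → ℂ) (n : ℤ) : ℂ :=
  fourierCoeff (fun t : UnitAddCircle => f (AddCircle.toCircle t)) n

/-- The Toeplitz minor `D_N^{λ,μ}(f) = det (d_{j - λ_j - k + μ_k})_{j,k=1}^N`. -/
def toeplitzMinor (N : ℕ) (la mu : YoungDiagram) (f : Circle → ℂ) : ℂ :=
  Matrix.det (Matrix.of fun j k : Fin N =>
    circleCoeff f ((j : ℤ) - la.rowLen j - (k : ℤ) + mu.rowLen k))

/-- The pure Fisher–Hartwig symbol `φ_{γ,δ}(z) = (1 + z)^γ (1 + z⁻¹)^δ`, for integers `γ, δ`. -/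
def pureFH (γ δ : ℕ) (z : Circle) : ℂ :=
  (1 + (z : ℂ)) ^ γ * (1 + (z : ℂ)⁻¹) ^ δ

/-! ### The Morris integral -/

/-- The Morris integral over `(-π, π)^N` with weight `e^{iθ(γ-δ)/2} |1 + e^{iθ}|^{γ+δ}` and with
the polynomials `P(e^{iθ_1}, …, e^{iθ_N})` and `Q(e^{-iθ_1}, …, e^{-iθ_N})` inserted. -/
def morrisIntegral (N : ℕ) (γ δ : ℝ) (P Q : MvPolynomial (Fin N) ℂ) : ℂ :=
  1 / (N.factorial : ℂ) * (1 / (2 * (π : ℂ)) ^ N) *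
    ∫ θ in Set.univ.pi (fun _ : Fin N => Set.Ioo (-π) π),
      MvPolynomial.eval (fun j => Complex.exp ((θ j : ℂ) * Complex.I)) P *
      MvPolynomial.eval (fun j => Complex.exp (-(θ j : ℂ) * Complex.I)) Q *
      (∏ j, Complex.exp ((θ j : ℂ) * Complex.I * ((γ - δ : ℝ) : ℂ) / 2) *
        ((‖1 + Complex.exp ((θ j : ℂ) * Complex.I)‖ ^ (γ + δ) : ℝ) : ℂ)) *
      ∏ j, ∏ k ∈ Finset.Ioi j,
        ((‖Complex.exp ((θ j : ℂ) * Complex.I) - Complex.exp ((θ k : ℂ) * Complex.I)‖ ^ 2 : ℝ) : ℂ)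

/-! ### The explicit evaluation -/

/-- The Barnes function at a real argument, by its Weierstrass product
`G(1 + z) = (2π)^{z/2} e^{-(z + z²(1 + c))/2} ∏_{n ≥ 1} (1 + z/n)^n e^{z²/(2n) - z}`,
where `c` is the Euler–Mascheroni constant. -/
def barnesG (x : ℝ) : ℝ :=
  (2 * π) ^ ((x - 1) / 2) *
    Real.exp (-((x - 1) + (x - 1) ^ 2 * (1 + Real.eulerMascheroniConstant)) / 2) *
    ∏' n : ℕ, ((1 + (x - 1) / (n + 1)) ^ (n + 1) *
      Real.exp ((x - 1) ^ 2 / (2 * (n + 1)) - (x - 1)))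

/-- The explicit value
`G(N+2) G(M+N+2)/G(M+1) · G(M-d+1)/G(M-d+N+2) · G(d+1)/G(d+N+2)
  · Γ(M-d+j+1)/Γ(j+1) · Γ(d+k+1)/Γ(k+1)
  · ∑_{r=max(j,k)}^N Γ(r+1)/Γ(M+r+1) · binom(M-d+r-k-1, r-k) · binom(d+r-j-1, r-j)`;
here `Ring.choose x n = x (x-1) ⋯ (x-n+1) / n!`. -/
def explicitValue (N j k : ℕ) (M d : ℝ) : ℝ :=
  barnesG (N + 2) * (barnesG (M + N + 2) / barnesG (M + 1)) *
    (barnesG (M - d + 1) / barnesG (M - d + N + 2)) * (barnesG (d + 1) / barnesG (d + N + 2)) *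
    (Real.Gamma (M - d + j + 1) / Real.Gamma (j + 1)) *
    (Real.Gamma (d + k + 1) / Real.Gamma (k + 1)) *
    ∑ r ∈ Finset.Icc (max j k) N, Real.Gamma (r + 1) / Real.Gamma (M + r + 1) *
      Ring.choose (M - d + r - k - 1) (r - k) * Ring.choose (d + r - j - 1) (r - j)

end

/-! ### Evaluations of skew Schur polynomials and the branching rule -/

/-! Everything reduces to determinants in the Fourier coefficients of `(1 + z)^γ (1 + 1/z)^δ`, which
are `Γ(γ+δ+1) / (Γ(γ-n+1) Γ(δ+n+1))` (`fhIntegral_eq`).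

On the integral side, the squared Vandermonde product is a product of two Vandermonde determinants.
The bialternant formula (`skewSchurEval_bot_mul_vandermonde`) turns each, times its Schur
polynomial, into an alternant, and the Andréief identity (`integral_det_mul_det`) integrates the
product of the two alternants to a Toeplitz minor. This works for real parameters. On the
combinatorial side, for integer parameters the `n`-th coefficient is `binom(γ+δ, δ+n) =
e_{δ+n}(1^{γ+δ})`, so the minor is the dual Jacobi–Trudi determinant (`skewSchurEval_transpose`) of
the conjugate of `((δ^N)+μ)/λ`. Both determinantal formulas are proved by induction on the number of
variables from the branching rule for tableaux.

For `λ = (1^k)`, `μ = (1^j)` the minor is the `(N+1) × (N+1)` Toeplitz matrix with row `k` and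
column `j` deleted, hence a cofactor, that is, up to sign, the determinant times an entry of the
inverse. A Saalschütz-type binomial identity (`sum_intChoose`) gives an explicit LU factorization.
Its diagonal gives the determinant, and Vandermonde convolution inverts the two factors, whose
product yields the sum over `r`. The functional equation `G(x+1) = Γ(x) G(x)`, derived from the
Weierstrass product, rewrites the determinant in Barnes functions. The evaluation holds for all real
`g, d ≥ 0`, so it covers both the specialized skew Schur polynomial and the Morris integral. -/

open scoped Classical in
/-- The value of the skew Schur polynomial `s_{ka/la}` at the point `x`. -/
noncomputable def skewSchurEval {R : Type*} [CommRing R] (ka la : YoungDiagram) {n : ℕ}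
    (x : Fin n → R) : R :=
  if la ≤ ka then
    ∑ T : {c : ℕ × ℕ // c ∈ ka.cells \ la.cells} → Fin n with T ∈ skewTableaux ka la n,
      ∏ c, x (T c)
  else 0

/-- Values at points of an arbitrary ring allow induction on the number of variables by dropping the
last coordinate. The point `X` recovers the polynomial itself. -/
theorem skewSchur_eq_skewSchurEval (R : Type*) [CommRing R] (ka la : YoungDiagram) (n : ℕ) :
    skewSchur R ka la n = skewSchurEval ka la MvPolynomial.X := rfl

theorem eval_skewSchur {R : Type*} [CommRing R] (ka la : YoungDiagram) {n : ℕ} (x : Fin n → R) :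
    MvPolynomial.eval x (skewSchur R ka la n) = skewSchurEval ka la x := by
  unfold skewSchur skewSchurEval
  split_ifs <;> simp

theorem skewSchurEval_of_not_le {R : Type*} [CommRing R] {ka la : YoungDiagram} (h : ¬ la ≤ ka)
    {n : ℕ} (x : Fin n → R) : skewSchurEval ka la x = 0 := by
  simp [skewSchurEval, h]

theorem YoungDiagram.finite_Iic (ka : YoungDiagram) : {nu : YoungDiagram | nu ≤ ka}.Finite := by
  refine Set.Finite.of_finite_image (f := YoungDiagram.cells)
    (Set.Finite.subset (ka.cells.powerset.finite_toSet) ?_) ?_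
  · rintro _ ⟨nu, h, rfl⟩
    simpa using h
  · intro a _ b _ h
    exact YoungDiagram.ext h

theorem YoungDiagram.le_iff_rowLen {nu ka : YoungDiagram} :
    nu ≤ ka ↔ ∀ i, nu.rowLen i ≤ ka.rowLen i := by
  constructor
  · intro h i
    by_contra! hlt
    have := h (YoungDiagram.mem_iff_lt_rowLen.2 hlt)
    exact lt_irrefl _ (YoungDiagram.mem_iff_lt_rowLen.1 this)
  · rintro h ⟨i, j⟩ hc
    exact YoungDiagram.mem_iff_lt_rowLen.2 ((YoungDiagram.mem_iff_lt_rowLen.1 hc).trans_le (h i))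

theorem YoungDiagram.ext_rowLen {nu ka : YoungDiagram} (h : ∀ i, nu.rowLen i = ka.rowLen i) :
    nu = ka :=
  le_antisymm (YoungDiagram.le_iff_rowLen.2 fun i => (h i).le)
    (YoungDiagram.le_iff_rowLen.2 fun i => (h i).ge)

/-- `ka / nu` is a horizontal strip. -/
def IsHorizontalStrip (ka nu : YoungDiagram) : Prop :=
  nu ≤ ka ∧ ∀ i j, (i + 1, j) ∈ ka → (i, j) ∈ nu

open scoped Classical in
/-- The diagrams `nu` for which `ka / nu` is a horizontal strip. -/
noncomputable def horizontalStrips (ka : YoungDiagram) : Finset YoungDiagram :=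
  ka.finite_Iic.toFinset.filter (IsHorizontalStrip ka)

theorem mem_horizontalStrips {ka nu : YoungDiagram} :
    nu ∈ horizontalStrips ka ↔ IsHorizontalStrip ka nu := by
  simp only [horizontalStrips, Finset.mem_filter, Set.Finite.mem_toFinset, Set.mem_ofPred_eq,
    and_iff_right_iff_imp]
  exact fun h => h.1

/-- Go along the row and then down the column: the corner `(i, j')` lies in the skew shape because
both diagrams are lower sets. -/
theorem skewTableaux_mono {ka la : YoungDiagram} {n : ℕ}
    {T : {c : ℕ × ℕ // c ∈ ka.cells \ la.cells} → Fin n} (hT : T ∈ skewTableaux ka la n)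
    {c c' : {c : ℕ × ℕ // c ∈ ka.cells \ la.cells}} (h : c.1 ≤ c'.1) : T c ≤ T c' := by
  obtain ⟨⟨i, j⟩, hc⟩ := c
  obtain ⟨⟨i', j'⟩, hc'⟩ := c'
  obtain ⟨hi, hj⟩ := h
  simp only at hi hj
  have hm : (i, j') ∈ ka.cells \ la.cells := by
    simp only [Finset.mem_sdiff, YoungDiagram.mem_cells] at hc hc' ⊢
    exact ⟨ka.up_left_mem hi le_rfl hc'.1, fun h => hc.2 (la.up_left_mem le_rfl hj h)⟩
  have h1 : T ⟨(i, j), hc⟩ ≤ T ⟨(i, j'), hm⟩ := by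
    rcases hj.eq_or_lt with rfl | hj
    · exact le_rfl
    · exact hT.1 _ _ rfl hj
  have h2 : T ⟨(i, j'), hm⟩ ≤ T ⟨(i', j'), hc'⟩ := by
    rcases hi.eq_or_lt with rfl | hi
    · exact le_rfl
    · exact (hT.2 ⟨(i, j'), hm⟩ ⟨(i', j'), hc'⟩ rfl hi).le
  exact h1.trans h2

open scoped Classical in
/-- The cells of a tableau whose entry is not the largest letter, together with the inner
shape. -/
noncomputable def subShape {ka la : YoungDiagram} {n : ℕ}
    {T : {c : ℕ × ℕ // c ∈ ka.cells \ la.cells} → Fin (n + 1)}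
    (hT : T ∈ skewTableaux ka la (n + 1)) : YoungDiagram where
  cells := ka.cells.filter fun c => ∀ h : c ∈ ka.cells \ la.cells, T ⟨c, h⟩ ≠ Fin.last n
  isLowerSet := by
    intro c c' hle hc
    simp only [Finset.coe_filter, YoungDiagram.mem_cells, Set.mem_ofPred_eq] at hc ⊢
    refine ⟨ka.isLowerSet hle hc.1, fun h => ?_⟩
    have hc2 : c ∈ ka.cells \ la.cells := by
      simp only [Finset.mem_sdiff, YoungDiagram.mem_cells] at h ⊢
      exact ⟨hc.1, fun h' => h.2 (la.isLowerSet hle h')⟩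
    have := hc.2 hc2
    intro h3
    apply this
    have h4 := skewTableaux_mono hT (c := ⟨c', h⟩) (c' := ⟨c, hc2⟩) hle
    rw [h3] at h4
    exact le_antisymm (Fin.le_last _) h4

theorem mem_subShape {ka la : YoungDiagram} {n : ℕ}
    {T : {c : ℕ × ℕ // c ∈ ka.cells \ la.cells} → Fin (n + 1)}
    (hT : T ∈ skewTableaux ka la (n + 1)) (c : ℕ × ℕ) :
    c ∈ subShape hT ↔ c ∈ ka ∧ ∀ h : c ∈ ka.cells \ la.cells, T ⟨c, h⟩ ≠ Fin.last n := by
  rw [← YoungDiagram.mem_cells]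
  simp [subShape]

open scoped Classical in
/-- Extension of a filling of `nu / la` to `ka / la` by the largest letter. -/
noncomputable def extendFilling (ka : YoungDiagram) {la nu : YoungDiagram} {n : ℕ}
    (T : {c : ℕ × ℕ // c ∈ nu.cells \ la.cells} → Fin n) :
    {c : ℕ × ℕ // c ∈ ka.cells \ la.cells} → Fin (n + 1) :=
  fun c => if h : c.1 ∈ nu.cells \ la.cells then (T ⟨c.1, h⟩).castSucc else Fin.last n

theorem extendFilling_mem {ka la nu : YoungDiagram} {n : ℕ} (hs : IsHorizontalStrip ka nu)
    {T : {c : ℕ × ℕ // c ∈ nu.cells \ la.cells} → Fin n} (hT : T ∈ skewTableaux nu la n) :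
    extendFilling ka T ∈ skewTableaux ka la (n + 1) := by
  constructor
  · rintro ⟨⟨i, j⟩, hc⟩ ⟨⟨i', j'⟩, hc'⟩ h1 h2
    simp only at h1 h2
    subst h1
    unfold extendFilling
    simp only [Finset.mem_sdiff, YoungDiagram.mem_cells] at hc hc' ⊢
    by_cases h : (i, j') ∈ nu ∧ (i, j') ∉ la
    · have h' : (i, j) ∈ nu ∧ (i, j) ∉ la := ⟨nu.up_left_mem le_rfl h2.le h.1, hc.2⟩
      rw [dif_pos h, dif_pos h']
      simp only [Fin.castSucc_le_castSucc_iff]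
      exact hT.1 _ _ rfl h2
    · rw [dif_neg h]
      exact Fin.le_last _
  · rintro ⟨⟨i, j⟩, hc⟩ ⟨⟨i', j'⟩, hc'⟩ h1 h2
    simp only at h1 h2
    subst h1
    unfold extendFilling
    simp only [Finset.mem_sdiff, YoungDiagram.mem_cells] at hc hc' ⊢
    have h' : (i, j) ∈ nu ∧ (i, j) ∉ la :=
      ⟨hs.2 _ _ (ka.up_left_mem h2 le_rfl hc'.1), hc.2⟩
    rw [dif_pos h']
    by_cases h : (i', j) ∈ nu ∧ (i', j) ∉ la
    · rw [dif_pos h]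
      simp only [Fin.castSucc_lt_castSucc_iff]
      exact hT.2 _ _ rfl h2
    · rw [dif_neg h]
      exact Fin.castSucc_lt_last _

open scoped Classical in
theorem prod_extendFilling {R : Type*} [CommRing R] {ka la nu : YoungDiagram} {n : ℕ}
    (hk : nu ≤ ka) (hl : la ≤ nu) (x : Fin (n + 1) → R)
    (T : {c : ℕ × ℕ // c ∈ nu.cells \ la.cells} → Fin n) :
    ∏ c, x (extendFilling ka T c) =
      x (Fin.last n) ^ (ka.cells \ nu.cells).card * ∏ c, x (T c).castSucc := by
  set g : ℕ × ℕ → R := fun c => if h : c ∈ nu.cells \ la.cells then x (T ⟨c, h⟩).castSucc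
    else x (Fin.last n) with hg
  have h1 : ∏ c, x (extendFilling ka T c) = ∏ c ∈ ka.cells \ la.cells, g c := by
    rw [← Finset.prod_coe_sort _ g]
    refine Finset.prod_congr rfl fun c _ => ?_
    simp only [hg, extendFilling]
    split_ifs <;> rfl
  have h2 : ∏ c, x (T c).castSucc = ∏ c ∈ nu.cells \ la.cells, g c := by
    rw [← Finset.prod_coe_sort _ g]
    refine Finset.prod_congr rfl fun c _ => ?_
    simp only [hg]
    rw [dif_pos c.2]
  have h3 : ∏ c ∈ ka.cells \ nu.cells, g c = x (Fin.last n) ^ (ka.cells \ nu.cells).card := by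
    rw [← Finset.prod_const]
    refine Finset.prod_congr rfl fun c hc => ?_
    simp only [hg]
    rw [dif_neg]
    simp only [Finset.mem_sdiff] at hc ⊢
    tauto
  have hk' := YoungDiagram.cells_subset_iff.2 hk
  have hl' := YoungDiagram.cells_subset_iff.2 hl
  rw [h1, h2, ← h3, ← Finset.prod_union]
  · congr 1
    ext c
    have := @hk' c
    have := @hl' c
    simp only [Finset.mem_sdiff, Finset.mem_union]
    tauto
  · rw [Finset.disjoint_left]
    intro c hc hc'
    simp only [Finset.mem_sdiff] at hc hc'
    exact hc.2 hc'.1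

open scoped Classical in
/-- The branching rule: split off the cells containing the largest letter. -/
theorem skewSchurEval_succ {R : Type*} [CommRing R] (ka la : YoungDiagram) {n : ℕ}
    (x : Fin (n + 1) → R) :
    skewSchurEval ka la x = ∑ nu ∈ horizontalStrips ka,
      x (Fin.last n) ^ (ka.cells \ nu.cells).card *
        skewSchurEval nu la (fun i : Fin n => x i.castSucc) := by
  by_cases hle : la ≤ ka
  swap
  · rw [skewSchurEval_of_not_le hle]
    refine (Finset.sum_eq_zero fun nu hnu => ?_).symm
    rw [skewSchurEval_of_not_le, mul_zero]
    exact fun h => hle (h.trans (mem_horizontalStrips.1 hnu).1)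
  rw [← Finset.sum_filter_of_ne (p := fun nu => la ≤ nu)]
  swap
  · intro nu _ h
    by_contra hn
    rw [skewSchurEval_of_not_le hn, mul_zero] at h
    exact h rfl
  have h1 : ∀ nu ∈ (horizontalStrips ka).filter (fun nu => la ≤ nu),
      x (Fin.last n) ^ (ka.cells \ nu.cells).card *
        skewSchurEval nu la (fun i : Fin n => x i.castSucc) =
      ∑ T ∈ Finset.univ.filter (fun T : {c : ℕ × ℕ // c ∈ nu.cells \ la.cells} → Fin n =>
          T ∈ skewTableaux nu la n), ∏ c, x (extendFilling ka T c) := by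
    intro nu hnu
    rw [Finset.mem_filter, mem_horizontalStrips] at hnu
    rw [skewSchurEval, if_pos hnu.2, Finset.mul_sum]
    exact Finset.sum_congr rfl fun T _ => (prod_extendFilling hnu.1.1 hnu.2 x T).symm
  rw [Finset.sum_congr rfl h1, Finset.sum_sigma', skewSchurEval, if_pos hle]
  symm
  refine Finset.sum_bij (fun p _ => extendFilling ka p.2) ?_ ?_ ?_ ?_
  · rintro ⟨nu, T⟩ h
    simp only [Finset.mem_sigma, Finset.mem_filter, mem_horizontalStrips, Finset.mem_univ,
      true_and] at h ⊢
    exact extendFilling_mem h.1.1 h.2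
  · rintro ⟨nu, T⟩ h ⟨nu', T'⟩ h' heq
    simp only [Finset.mem_sigma, Finset.mem_filter, mem_horizontalStrips, Finset.mem_univ,
      true_and] at h h' heq
    -- Injectivity: the extended filling determines `nu`, as `la` together with the cells whose
    -- entry is not the largest letter.
    have key : ∀ (nu : YoungDiagram) (T : {c : ℕ × ℕ // c ∈ nu.cells \ la.cells} → Fin n),
        nu ≤ ka → la ≤ nu → ∀ c : ℕ × ℕ, c ∈ nu ↔ c ∈ la ∨ ∃ h : c ∈ ka.cells \ la.cells,
          extendFilling ka T ⟨c, h⟩ ≠ Fin.last n := by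
      intro nu T hk hl c
      constructor
      · intro hc
        by_cases hcl : c ∈ la
        · exact Or.inl hcl
        · refine Or.inr ⟨by simpa using ⟨hk hc, hcl⟩, ?_⟩
          rw [extendFilling, dif_pos (by simpa using ⟨hc, hcl⟩)]
          exact (Fin.castSucc_lt_last _).ne
      · rintro (hc | ⟨hc, hne⟩)
        · exact hl hc
        · by_contra hn
          rw [extendFilling, dif_neg (by simp [hn])] at hne
          exact hne rfl
    have hnu : nu = nu' := by
      apply SetLike.ext
      intro c
      rw [key nu T h.1.1.1 h.1.2, key nu' T' h'.1.1.1 h'.1.2, heq]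
    subst hnu
    congr 1
    funext c
    have hc : c.1 ∈ ka.cells \ la.cells := by
      have := c.2
      simp only [Finset.mem_sdiff, YoungDiagram.mem_cells] at this ⊢
      exact ⟨h.1.1.1 this.1, this.2⟩
    have := congrFun heq ⟨c.1, hc⟩
    simp only [extendFilling] at this
    rw [dif_pos c.2, dif_pos c.2] at this
    exact Fin.castSucc_injective _ this
  · intro T hT
    simp only [Finset.mem_filter, Finset.mem_univ, true_and] at hT
    have hsub : ∀ c, c ∈ (subShape hT).cells \ la.cells → ∃ h : c ∈ ka.cells \ la.cells,
        T ⟨c, h⟩ ≠ Fin.last n := by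
      intro c hc
      rw [Finset.mem_sdiff, YoungDiagram.mem_cells, mem_subShape] at hc
      have : c ∈ ka.cells \ la.cells := by
        simp only [Finset.mem_sdiff, YoungDiagram.mem_cells] at hc ⊢
        exact ⟨hc.1.1, hc.2⟩
      exact ⟨this, hc.1.2 this⟩
    refine ⟨⟨subShape hT, fun c => (T ⟨c.1, (hsub c.1 c.2).1⟩).castPred (hsub c.1 c.2).2⟩, ?_, ?_⟩
    · simp only [Finset.mem_sigma, Finset.mem_filter, mem_horizontalStrips, Finset.mem_univ,
        true_and]
      refine ⟨⟨⟨fun c hc => ((mem_subShape hT c).1 hc).1, fun i j hij => ?_⟩, fun c hc => ?_⟩,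
        ?_, ?_⟩
      · rw [mem_subShape]
        refine ⟨ka.up_left_mem (Nat.le_succ _) le_rfl hij, fun h => ?_⟩
        have h' : (i + 1, j) ∈ ka.cells \ la.cells := by
          simp only [Finset.mem_sdiff, YoungDiagram.mem_cells] at h ⊢
          exact ⟨hij, fun hl => h.2 (la.up_left_mem (Nat.le_succ _) le_rfl hl)⟩
        exact ((hT.2 ⟨(i, j), h⟩ ⟨(i + 1, j), h'⟩ rfl (Nat.lt_succ_self _)).trans_le
          (Fin.le_last _)).ne
      · rw [mem_subShape]
        refine ⟨hle hc, fun h => ?_⟩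
        simp only [Finset.mem_sdiff, YoungDiagram.mem_cells] at h
        exact absurd hc h.2
      · intro c c' h1 h2
        exact hT.1 _ _ h1 h2
      · intro c c' h1 h2
        exact hT.2 _ _ h1 h2
    · funext c
      simp only [extendFilling]
      split_ifs with h
      · simp
      · by_contra hne
        apply h
        have := c.2
        rw [Finset.mem_sdiff, YoungDiagram.mem_cells, mem_subShape]
        simp only [Finset.mem_sdiff, YoungDiagram.mem_cells] at this ⊢
        exact ⟨⟨this.1, fun _ h' => hne h'.symm⟩, this.2⟩
  · intros
    rfl

open scoped Classical in
theorem skewSchurEval_zero {R : Type*} [CommRing R] (ka la : YoungDiagram) (x : Fin 0 → R) :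
    skewSchurEval ka la x = if ka = la then 1 else 0 := by
  unfold skewSchurEval
  by_cases h : ka = la
  · subst h
    have : IsEmpty {c : ℕ × ℕ // c ∈ ka.cells \ ka.cells} := by
      rw [Finset.sdiff_self]
      exact ⟨fun c => Finset.notMem_empty _ c.2⟩
    rw [if_pos le_rfl, if_pos rfl, Finset.filter_true_of_mem]
    · simp
    · intro T _
      exact ⟨fun c => (this.false c).elim, fun c => (this.false c).elim⟩
  · rw [if_neg h]
    split_ifs with hle
    · refine Finset.sum_eq_zero fun T _ => ?_
      have : ∃ c, c ∈ ka.cells \ la.cells := by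
        by_contra! hn
        refine h (le_antisymm (fun c hc => ?_) hle)
        by_contra hc'
        exact hn c (by simpa using ⟨hc, hc'⟩)
      obtain ⟨c, hc⟩ := this
      exact (T ⟨c, hc⟩).elim0
    · rfl

/-! ### Diagrams given by their row lengths -/

/-- The Young diagram with row lengths `f`. -/
def YoungDiagram.ofAntitone (f : ℕ → ℕ) (hf : Antitone f) (N : ℕ) : YoungDiagram where
  cells := (Finset.range N ×ˢ Finset.range (f 0)).filter fun c => c.2 < f c.1
  isLowerSet := by
    rintro ⟨i, j⟩ ⟨i', j'⟩ ⟨h1, h2⟩ h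
    simp only [Finset.coe_filter, Finset.mem_product, Finset.mem_range, Set.mem_ofPred_eq] at h ⊢
    simp only at h1 h2
    have := hf h1
    omega

theorem YoungDiagram.rowLen_ofAntitone {f : ℕ → ℕ} (hf : Antitone f) {N : ℕ}
    (hN : ∀ i, N ≤ i → f i = 0) (i : ℕ) : (YoungDiagram.ofAntitone f hf N).rowLen i = f i := by
  refine eq_of_forall_lt_iff fun j => ?_
  rw [← YoungDiagram.mem_iff_lt_rowLen, ← YoungDiagram.mem_cells]
  simp only [YoungDiagram.ofAntitone, Finset.mem_filter, Finset.mem_product, Finset.mem_range]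
  have := hf (Nat.zero_le i)
  have := hN i
  omega

theorem YoungDiagram.colLen_zero_le_iff {ka : YoungDiagram} {N : ℕ} :
    ka.colLen 0 ≤ N ↔ ∀ i, N ≤ i → ka.rowLen i = 0 := by
  constructor
  · intro h i hi
    by_contra hne
    have h1 : (i, 0) ∈ ka := YoungDiagram.mem_iff_lt_rowLen.2 (Nat.pos_of_ne_zero hne)
    have := YoungDiagram.mem_iff_lt_colLen.1 h1
    omega
  · intro h
    by_contra! hlt
    have h1 := YoungDiagram.mem_iff_lt_rowLen.1 (YoungDiagram.mem_iff_lt_colLen.2 hlt)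
    have := h N le_rfl
    omega

theorem YoungDiagram.card_sdiff_cells {ka nu : YoungDiagram} {N : ℕ} (hN : ka.colLen 0 ≤ N) :
    (ka.cells \ nu.cells).card = ∑ i : Fin N, (ka.rowLen i - nu.rowLen i) := by
  rw [Finset.card_eq_sum_card_fiberwise (f := Prod.fst) (t := Finset.range N),
    Fin.sum_univ_eq_sum_range (fun i => ka.rowLen i - nu.rowLen i)]
  · refine Finset.sum_congr rfl fun i _ => ?_
    have : (ka.cells \ nu.cells).filter (fun c => c.1 = i) =
        {i} ×ˢ Finset.Ico (nu.rowLen i) (ka.rowLen i) := by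
      ext ⟨a, b⟩
      simp only [Finset.mem_filter, Finset.mem_sdiff, YoungDiagram.mem_cells,
        YoungDiagram.mem_iff_lt_rowLen, Finset.mem_product, Finset.mem_singleton, Finset.mem_Ico]
      constructor
      · rintro ⟨⟨h1, h2⟩, rfl⟩
        omega
      · rintro ⟨rfl, h1, h2⟩
        omega
    rw [this]
    simp
  · rintro ⟨a, b⟩ h
    simp only [Finset.coe_sdiff, Set.mem_sdiff, Finset.mem_coe, YoungDiagram.mem_cells] at h
    have h1 := YoungDiagram.mem_iff_lt_colLen.1 h.1
    have := ka.colLen_anti 0 b (Nat.zero_le b)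
    simp only [Finset.coe_range, Set.mem_Iio]
    omega

theorem YoungDiagram.card_sdiff_cells_transpose (ka nu : YoungDiagram) :
    (ka.transpose.cells \ nu.transpose.cells).card = (ka.cells \ nu.cells).card := by
  refine Finset.card_bij (fun c _ => c.swap) ?_ ?_ ?_
  · intro c hc
    simpa only [Finset.mem_sdiff, YoungDiagram.mem_cells, YoungDiagram.mem_transpose] using hc
  · intro a _ b _ h
    exact Prod.swap_injective h
  · intro c hc
    refine ⟨c.swap, ?_, c.swap_swap⟩
    simpa only [Finset.mem_sdiff, YoungDiagram.mem_cells, YoungDiagram.mem_transpose,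
      Prod.swap_swap] using hc

/-- Conjugation turns horizontal strips into vertical ones. These lower each part by 0 or 1, which
is what matches them with sets of rows in the dual Jacobi–Trudi determinant. -/
theorem isHorizontalStrip_transpose_iff {ka nu : YoungDiagram} :
    IsHorizontalStrip ka.transpose nu.transpose ↔
      nu ≤ ka ∧ ∀ i, ka.rowLen i ≤ nu.rowLen i + 1 := by
  rw [IsHorizontalStrip, YoungDiagram.transpose_le_iff]
  refine and_congr_right fun _ => ?_
  simp only [YoungDiagram.mem_transpose, Prod.swap_prod_mk]
  simp only [YoungDiagram.mem_iff_lt_rowLen]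
  constructor
  · intro h i
    by_contra! hlt
    have := h (nu.rowLen i) i (by omega)
    omega
  · intro h i j hij
    have := h j
    omega

/-! ### Elementary symmetric polynomials with integer index -/

open Polynomial in
/-- The elementary symmetric polynomial `e_m` at the point `x`, zero for `m < 0`. -/
noncomputable def elemSymm {R : Type*} [CommRing R] {n : ℕ} (x : Fin n → R) (m : ℤ) : R :=
  if 0 ≤ m then (∏ i, (1 + C (x i) * X)).coeff m.toNat else 0

theorem elemSymm_of_neg {R : Type*} [CommRing R] {n : ℕ} (x : Fin n → R) {m : ℤ} (hm : m < 0) :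
    elemSymm x m = 0 := by
  simp [elemSymm, hm.not_ge]

theorem elemSymm_zero_vars {R : Type*} [CommRing R] (x : Fin 0 → R) (m : ℤ) :
    elemSymm x m = if m = 0 then 1 else 0 := by
  unfold elemSymm
  simp only [Finset.univ_eq_empty, Finset.prod_empty, Polynomial.coeff_one]
  split_ifs <;> first | rfl | omega

/-- Comes from the last factor `1 + x_n X` of the generating product. Vanishing at negative index
makes it hold for every integer `m`. -/
theorem elemSymm_succ {R : Type*} [CommRing R] {n : ℕ} (x : Fin (n + 1) → R) (m : ℤ) :
    elemSymm x m = x (Fin.last n) * elemSymm (fun i : Fin n => x i.castSucc) (m - 1) +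
      elemSymm (fun i : Fin n => x i.castSucc) m := by
  rcases lt_trichotomy m 0 with hm | rfl | hm
  · rw [elemSymm_of_neg _ hm, elemSymm_of_neg _ hm, elemSymm_of_neg _ (by omega)]
    simp
  · rw [elemSymm_of_neg _ (show (0 : ℤ) - 1 < 0 by omega)]
    simp [elemSymm, Fin.prod_univ_castSucc]
  · obtain ⟨k, rfl⟩ : ∃ k : ℕ, m = k + 1 := ⟨(m - 1).toNat, by omega⟩
    have h1 : ((k : ℤ) + 1).toNat = k + 1 := by omega
    simp only [elemSymm, Fin.prod_univ_castSucc, mul_add, mul_one, Polynomial.coeff_add, h1,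
      add_sub_cancel_right, Int.toNat_natCast, Nat.cast_nonneg, if_true,
      if_pos (show (0 : ℤ) ≤ k + 1 by omega)]
    rw [mul_left_comm, ← mul_assoc, Polynomial.coeff_mul_X, Polynomial.coeff_C_mul]
    ring

theorem elemSymm_natCast {R : Type*} [CommRing R] {n : ℕ} (x : Fin n → R) (k : ℕ) :
    elemSymm x k = ∑ s ∈ Finset.powersetCard k Finset.univ, ∏ i ∈ s, x i := by
  classical
  rw [elemSymm, if_pos (by omega), Int.toNat_natCast, Finset.prod_one_add, Polynomial.finsetSum_coeff]
  have : ∀ s : Finset (Fin n),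
      (∏ i ∈ s, (Polynomial.C (x i) * Polynomial.X)).coeff k = if s.card = k then ∏ i ∈ s, x i else 0 := by
    intro s
    rw [Finset.prod_mul_distrib, Finset.prod_const, ← map_prod, Polynomial.coeff_C_mul_X_pow]
    simp only [eq_comm]
  simp only [this]
  rw [← Finset.sum_filter, Finset.powersetCard_eq_filter]

theorem elemSymm_one {R : Type*} [CommRing R] (n : ℕ) (m : ℤ) :
    elemSymm (fun _ : Fin n => (1 : R)) m = if 0 ≤ m then (n.choose m.toNat : R) else 0 := by
  split_ifs with h
  · obtain ⟨k, rfl⟩ := Int.eq_ofNat_of_zero_le h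
    simp [elemSymm_natCast]
  · exact elemSymm_of_neg _ (by omega)

/-! ### The dual Jacobi–Trudi identity -/

/-- Each row splits into two by `elemSymm_succ`. Multilinearity gives a sum over the set `s` of rows
taking the term with lowered index. -/
theorem det_elemSymm_succ {R : Type*} [CommRing R] {n N : ℕ} (x : Fin (n + 1) → R)
    (a b : Fin N → ℤ) :
    Matrix.det (Matrix.of fun i j => elemSymm x (a i - b j)) =
      ∑ s : Finset (Fin N), x (Fin.last n) ^ s.card *
        Matrix.det (Matrix.of fun i j =>
          elemSymm (fun i : Fin n => x i.castSucc) ((a i - if i ∈ s then 1 else 0) - b j)) := by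
  classical
  set y : Fin n → R := fun i => x i.castSucc
  have h := (Matrix.detRowAlternating (R := R) (n := Fin N)).toMultilinearMap.map_add_univ
    (fun i j => x (Fin.last n) * elemSymm y (a i - 1 - b j)) (fun i j => elemSymm y (a i - b j))
  have hl : (Matrix.of fun i j => elemSymm x (a i - b j)) =
      (fun i j => x (Fin.last n) * elemSymm y (a i - 1 - b j)) +
        (fun i j => elemSymm y (a i - b j)) := by
    funext i j
    simp only [Matrix.of_apply, Pi.add_apply]
    rw [elemSymm_succ, show a i - b j - 1 = a i - 1 - b j by ring]
  rw [hl]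
  refine h.trans (Finset.sum_congr rfl fun s _ => ?_)
  have hs : x (Fin.last n) ^ s.card = ∏ i, if i ∈ s then x (Fin.last n) else 1 := by
    rw [Finset.prod_ite_mem, Finset.univ_inter, Finset.prod_const]
  rw [hs, ← Matrix.det_mul_column]
  change Matrix.det _ = _
  congr 1
  funext i j
  by_cases hi : i ∈ s <;> simp [Finset.piecewise, hi]

/-- The numbers `κ_i - i` and `λ_j - j` strictly decrease. If the partitions are equal the matrix is
the identity. Otherwise, at the first differing index the larger of the two numbers is absent from
the other sequence, giving a zero row or column. -/
theorem det_indicator_rowLen {R : Type*} [CommRing R] {N : ℕ} {ka la : YoungDiagram}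
    (hk : ka.colLen 0 ≤ N) (hl : la.colLen 0 ≤ N) [Decidable (ka = la)] :
    Matrix.det (Matrix.of fun i j : Fin N =>
      if ((ka.rowLen i : ℤ) - i) - (la.rowLen j - j) = 0 then (1 : R) else 0) =
      if ka = la then 1 else 0 := by
  have hanti : ∀ (mu : YoungDiagram) {i j : ℕ}, i < j →
      (mu.rowLen j : ℤ) - j < mu.rowLen i - i := by
    intro mu i j hij
    have := mu.rowLen_anti i j hij.le
    omega
  split_ifs with h
  · subst h
    refine Eq.trans (congrArg Matrix.det ?_) (Matrix.det_one (n := Fin N))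
    ext i j
    rw [Matrix.of_apply, Matrix.one_apply]
    refine if_congr ?_ rfl rfl
    constructor
    · intro h
      rcases lt_trichotomy i j with hij | hij | hij
      · have := hanti ka (i := i) (j := j) hij
        omega
      · exact hij
      · have := hanti ka (i := j) (j := i) hij
        omega
    · rintro rfl
      ring
  · have hex : ∃ i, ka.rowLen i ≠ la.rowLen i := by
      by_contra! hn
      exact h (YoungDiagram.ext_rowLen hn)
    classical
    have hi := Nat.find_spec hex
    have hmin : ∀ m, m < Nat.find hex → ka.rowLen m = la.rowLen m := fun m hm =>
      not_not.1 (Nat.find_min hex hm)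
    set i := Nat.find hex
    have hiN : i < N := by
      by_contra! hn
      rw [YoungDiagram.colLen_zero_le_iff.1 hk i hn, YoungDiagram.colLen_zero_le_iff.1 hl i hn] at hi
      exact hi rfl
    rcases lt_or_gt_of_ne hi with hlt | hlt
    · refine Matrix.det_eq_zero_of_column_eq_zero ⟨i, hiN⟩ fun j => ?_
      rw [Matrix.of_apply, if_neg]
      simp only
      rcases lt_or_ge (j : ℕ) i with hj | hj
      · have := hmin j hj
        have := hanti la hj
        omega
      · have := ka.rowLen_anti i j hj
        omega
    · refine Matrix.det_eq_zero_of_row_eq_zero ⟨i, hiN⟩ fun j => ?_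
      rw [Matrix.of_apply, if_neg]
      simp only
      rcases lt_or_ge (j : ℕ) i with hj | hj
      · have := hmin j hj
        have := hanti ka hj
        omega
      · have := la.rowLen_anti i j hj
        omega

open scoped Classical in
/-- The rows in which a vertical strip has a cell. -/
noncomputable def stripRows (N : ℕ) (ka nu : YoungDiagram) : Finset (Fin N) :=
  Finset.univ.filter fun i => nu.rowLen i < ka.rowLen i

/-- If lowering the rows in `s` does not leave a partition, there are two possible reasons. Either
`κ_i = κ_{i+1}` with only row `i` lowered, and then two rows of the matrix coincide; or the last
part is 0 and is lowered, and then that row has only negative indices. -/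
theorem det_elemSymm_eq_zero {R : Type*} [CommRing R] {n N : ℕ} (y : Fin n → R)
    {ka la : YoungDiagram} (hk : ka.colLen 0 ≤ N) (s : Finset (Fin N))
    (hs : ∀ nu : YoungDiagram, IsHorizontalStrip ka.transpose nu.transpose →
      stripRows N ka nu ≠ s) :
    Matrix.det (Matrix.of fun i j : Fin N => elemSymm y
      ((((ka.rowLen i : ℤ) - i) - if i ∈ s then 1 else 0) - (la.rowLen j - j))) = 0 := by
  classical
  by_cases hA : ∃ i i' : Fin N, (i' : ℕ) = i + 1 ∧ i ∈ s ∧ i' ∉ s ∧ ka.rowLen i = ka.rowLen i'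
  · obtain ⟨i, i', h1, h2, h3, h4⟩ := hA
    refine Matrix.det_zero_of_row_eq (i := i) (j := i') (by rintro rfl; omega) ?_
    funext j
    simp only [Matrix.of_apply, h2, h3, if_true, if_false, h4, h1]
    congr 1
    push_cast
    ring
  by_cases hB : ∃ i : Fin N, (i : ℕ) + 1 = N ∧ i ∈ s ∧ ka.rowLen i = 0
  · obtain ⟨i, h1, h2, h3⟩ := hB
    refine Matrix.det_eq_zero_of_row_eq_zero i fun j => ?_
    rw [Matrix.of_apply, elemSymm_of_neg]
    simp only [h2, if_true, h3]
    omega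
  exfalso
  push Not at hA hB
  -- A lowered row of length 0 would force the next row, also of length 0, to be lowered, and so on
  -- to the last row, which `hB` forbids. Here `d` is the distance to the last row. Consequently the
  -- truncated subtraction in `f` below is exact.
  have hpos : ∀ d : ℕ, ∀ i : Fin N, (i : ℕ) + d + 1 = N → i ∈ s → ka.rowLen i ≠ 0 := by
    intro d
    induction d with
    | zero => exact fun i hi => hB i (by omega)
    | succ d ih =>
      intro i hi his h0
      have hlt : (i : ℕ) + 1 < N := by omega
      have h2 := ka.rowLen_anti i (i + 1) (by omega)
      have h3 : ka.rowLen ((i : ℕ) + 1) = 0 := by omega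
      by_cases hmem : (⟨i + 1, hlt⟩ : Fin N) ∈ s
      · exact ih ⟨i + 1, hlt⟩ (by simp only; omega) hmem h3
      · exact hA i ⟨i + 1, hlt⟩ rfl his hmem (by simp only; omega)
  set f : ℕ → ℕ := fun i => ka.rowLen i - if h : i < N then (if (⟨i, h⟩ : Fin N) ∈ s then 1 else 0)
    else 0 with hf
  have hN := YoungDiagram.colLen_zero_le_iff.1 hk
  have hf0 : ∀ i, N ≤ i → f i = 0 := fun i hi => by simp [hf, hN i hi]
  have hanti : Antitone f := by
    refine antitone_nat_of_succ_le fun i => ?_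
    by_cases hi : i + 1 < N
    · have hi' : i < N := by omega
      have h1 := ka.rowLen_anti i (i + 1) (by omega)
      have h2 := hA ⟨i, hi'⟩ ⟨i + 1, hi⟩ rfl
      simp only [hf, hi, hi', dif_pos]
      by_cases h3 : (⟨i, hi'⟩ : Fin N) ∈ s
      · by_cases h4 : (⟨i + 1, hi⟩ : Fin N) ∈ s
        · simp only [h3, h4, if_true]
          omega
        · have := h2 h3 h4
          simp only at this
          simp only [h3, h4, if_true, if_false]
          omega
      · simp only [h3, if_false]
        omega
    · rw [hf0 (i + 1) (by omega)]
      exact Nat.zero_le _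
  have hrow := YoungDiagram.rowLen_ofAntitone hanti hf0
  refine hs (YoungDiagram.ofAntitone f hanti N) ?_ ?_
  · rw [isHorizontalStrip_transpose_iff, YoungDiagram.le_iff_rowLen]
    refine ⟨fun i => ?_, fun i => ?_⟩ <;> rw [hrow] <;> simp only [hf] <;> split_ifs <;> omega
  · ext i
    rw [stripRows, Finset.mem_filter, hrow]
    simp only [Finset.mem_univ, true_and, hf, i.2, dif_pos]
    by_cases his : i ∈ s
    · have := hpos (N - 1 - i) i (by omega) his
      simp only [his, if_true, iff_true]
      omega
    · simp [his]

/-- The dual Jacobi–Trudi identity. -/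
theorem skewSchurEval_transpose {R : Type*} [CommRing R] {n N : ℕ} (x : Fin n → R)
    {ka la : YoungDiagram} (hk : ka.colLen 0 ≤ N) (hl : la.colLen 0 ≤ N) :
    skewSchurEval ka.transpose la.transpose x =
      Matrix.det (Matrix.of fun i j : Fin N =>
        elemSymm x (((ka.rowLen i : ℤ) - i) - (la.rowLen j - j))) := by
  classical
  induction n generalizing ka with
  | zero =>
    rw [skewSchurEval_zero]
    simp only [elemSymm_zero_vars]
    rw [det_indicator_rowLen hk hl]
    exact if_congr YoungDiagram.transpose_eq_iff rfl rfl
  | succ n ih =>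
    have hN := YoungDiagram.colLen_zero_le_iff.1 hk
    rw [skewSchurEval_succ, det_elemSymm_succ x (fun i : Fin N => (ka.rowLen i : ℤ) - i)
      (fun j => (la.rowLen j : ℤ) - j)]
    have hvert : ∀ nu ∈ horizontalStrips ka.transpose, nu.transpose ≤ ka ∧
        ∀ i, ka.rowLen i ≤ nu.transpose.rowLen i + 1 := by
      intro nu hnu
      rw [mem_horizontalStrips, ← nu.transpose_transpose, isHorizontalStrip_transpose_iff] at hnu
      exact hnu
    have hrow : ∀ nu ∈ horizontalStrips ka.transpose, ∀ i : Fin N,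
        (nu.transpose.rowLen i : ℤ) =
          ka.rowLen i - if i ∈ stripRows N ka nu.transpose then 1 else 0 := by
      intro nu hnu i
      obtain ⟨h1, h2⟩ := hvert nu hnu
      have h1 := YoungDiagram.le_iff_rowLen.1 h1 i
      have h2 := h2 i
      simp only [stripRows, Finset.mem_filter, Finset.mem_univ, true_and]
      split_ifs <;> omega
    have hlen : ∀ nu ∈ horizontalStrips ka.transpose, ∀ i, N ≤ i →
        nu.transpose.rowLen i = 0 := by
      intro nu hnu i hi
      have := YoungDiagram.le_iff_rowLen.1 (hvert nu hnu).1 i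
      rw [hN i hi] at this
      omega
    -- The strips in the branching rule correspond injectively to row sets in the determinant
    -- expansion. The row sets that are missed contribute 0.
    refine Finset.sum_of_injOn (fun nu => stripRows N ka nu.transpose) ?_ ?_ ?_ ?_
    · intro nu hnu nu' hnu' heq
      simp only at heq
      rw [← YoungDiagram.transpose_eq_iff]
      refine YoungDiagram.ext_rowLen fun i => ?_
      by_cases hi : i < N
      · have h1 := hrow nu hnu ⟨i, hi⟩
        have h2 := hrow nu' hnu' ⟨i, hi⟩
        rw [heq, ← h2] at h1
        exact_mod_cast h1
      · rw [hlen nu hnu i (by omega), hlen nu' hnu' i (by omega)]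
    · exact fun _ _ => Finset.mem_coe.2 (Finset.mem_univ _)
    · intro s _ hs
      rw [det_elemSymm_eq_zero _ hk s, mul_zero]
      intro nu hnu heq
      exact hs ⟨nu.transpose, Finset.mem_coe.2 (mem_horizontalStrips.2 hnu),
        by simpa only [YoungDiagram.transpose_transpose] using heq⟩
    · intro nu hnu
      congr 1
      · rw [← nu.transpose_transpose, YoungDiagram.card_sdiff_cells_transpose,
          YoungDiagram.card_sdiff_cells hk, YoungDiagram.transpose_transpose, stripRows,
          Finset.card_filter]
        congr 1
        refine Finset.sum_congr rfl fun i _ => ?_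
        obtain ⟨h1, h2⟩ := hvert nu hnu
        have h1 := YoungDiagram.le_iff_rowLen.1 h1 i
        have h2 := h2 i
        split_ifs <;> omega
      · conv_lhs => rw [← nu.transpose_transpose]
        rw [ih _ (YoungDiagram.colLen_zero_le_iff.2 (hlen nu hnu))]
        congr 1
        ext i j
        simp only [Matrix.of_apply]
        rw [hrow nu hnu i]
        congr 1
        ring

/-! ### The bialternant formula -/

theorem isHorizontalStrip_iff_rowLen {ka nu : YoungDiagram} :
    IsHorizontalStrip ka nu ↔ nu ≤ ka ∧ ∀ i, ka.rowLen (i + 1) ≤ nu.rowLen i := by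
  rw [IsHorizontalStrip]
  refine and_congr_right fun _ => ?_
  simp only [YoungDiagram.mem_iff_lt_rowLen]
  constructor
  · intro h i
    by_contra! hlt
    exact lt_irrefl _ (h i _ hlt)
  · intro h i j hij
    exact hij.trans_le (h i)

/-- Removing a horizontal strip shortens the first column by at most one cell, so `n` letters cannot
exhaust a longer column. -/
theorem skewSchurEval_bot_eq_zero {R : Type*} [CommRing R] {n : ℕ} (x : Fin n → R)
    {la : YoungDiagram} (h : n < la.colLen 0) : skewSchurEval la ⊥ x = 0 := by
  classical
  induction n generalizing la with
  | zero =>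
    rw [skewSchurEval_zero, if_neg]
    rintro rfl
    exact YoungDiagram.notMem_bot _ (YoungDiagram.mem_iff_lt_colLen.2 h)
  | succ n ih =>
    rw [skewSchurEval_succ]
    refine Finset.sum_eq_zero fun nu hnu => ?_
    rw [ih, mul_zero]
    exact YoungDiagram.mem_iff_lt_colLen.1
      ((mem_horizontalStrips.1 hnu).2 n 0 (YoungDiagram.mem_iff_lt_colLen.2 h))

/-- Subtracting from each column a power of `z`, the last variable, times the previous column clears
the last row except for its first entry. After expansion along that row, row `i` is divisible by
`x_i - z`, with geometric sums as quotients. -/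
theorem det_pow_succ {R : Type*} [CommRing R] {n : ℕ} (x : Fin (n + 1) → R)
    {m : Fin (n + 1) → ℕ} (hm : ∀ j : Fin n, m j.castSucc ≤ m j.succ) :
    Matrix.det (Matrix.of fun i j => x i ^ m j) =
      (-1) ^ n * x (Fin.last n) ^ m 0 * (∏ i : Fin n, (x i.castSucc - x (Fin.last n))) *
        Matrix.det (Matrix.of fun i j : Fin n => ∑ p ∈ Finset.Ico (m j.castSucc) (m j.succ),
          x i.castSucc ^ p * x (Fin.last n) ^ (m j.succ - 1 - p)) := by
  set z := x (Fin.last n) with hz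
  set B : Matrix (Fin (n + 1)) (Fin (n + 1)) R := Matrix.of fun i j =>
    Fin.cases (x i ^ m 0)
      (fun j => x i ^ m j.succ - x i ^ m j.castSucc * z ^ (m j.succ - m j.castSucc)) j with hB
  have hB0 : ∀ i, B i 0 = x i ^ m 0 := fun i => rfl
  have hBs : ∀ i (j : Fin n), B i j.succ =
      x i ^ m j.succ - x i ^ m j.castSucc * z ^ (m j.succ - m j.castSucc) := fun i j => rfl
  rw [Matrix.det_eq_of_forall_col_eq_smul_add_pred (B := B)
    (fun j => z ^ (m j.succ - m j.castSucc))]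
  · rw [Matrix.det_succ_row B (Fin.last n), Finset.sum_eq_single 0]
    · rw [hB0, Fin.val_last, Fin.val_zero, add_zero, mul_assoc ((-1) ^ n * _)]
      congr 1
      rw [← Matrix.det_mul_column]
      congr 1
      ext i j
      rw [Matrix.submatrix_apply, Fin.succAbove_last, Fin.succAbove_zero, hBs, Matrix.of_apply,
        Matrix.of_apply, mul_geom_sum₂_Ico _ _ (hm j)]
    · intro j _ hj
      obtain ⟨j, rfl⟩ := Fin.exists_succ_eq.2 hj
      rw [hBs, ← hz, ← pow_add, Nat.add_sub_cancel' (hm j)]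
      simp
    · simp
  · intro i
    rfl
  · intro i j
    rw [hBs, Matrix.of_apply, Matrix.of_apply]
    ring

theorem det_vandermonde_succ_last {R : Type*} [CommRing R] {n : ℕ} (x : Fin (n + 1) → R) :
    (Matrix.vandermonde x).det =
      (-1) ^ n * (∏ i : Fin n, (x i.castSucc - x (Fin.last n))) *
        (Matrix.vandermonde fun i : Fin n => x i.castSucc).det := by
  have h := det_pow_succ x (m := fun j => (j : ℕ)) (fun j => by simp)
  simp only [Fin.val_castSucc, Fin.val_succ, Fin.val_zero, pow_zero, mul_one] at h
  refine h.trans ?_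
  congr 2
  ext i j
  simp [Matrix.vandermonde_apply]

theorem det_sum_pow {R : Type*} [CommRing R] {n : ℕ} (y : Fin n → R) (z : R)
    (A : Fin n → Finset ℕ) (e : Fin n → ℕ) :
    Matrix.det (Matrix.of fun i j : Fin n => ∑ p ∈ A j, y i ^ p * z ^ (e j - p)) =
      ∑ r ∈ Fintype.piFinset A, (∏ j, z ^ (e j - r j)) *
        Matrix.det (Matrix.of fun i j => y i ^ r j) := by
  have h := (Matrix.detRowAlternating (R := R) (n := Fin n)).toMultilinearMap.map_sum_finset
    (fun j p i => y i ^ p * z ^ (e j - p)) A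
  rw [← Matrix.det_transpose]
  refine Eq.trans ?_ (h.trans (Finset.sum_congr rfl fun r _ => ?_))
  · change Matrix.det _ = Matrix.det _
    congr 1
    ext j i
    simp [Matrix.transpose_apply]
  · rw [← Matrix.det_mul_row, ← Matrix.det_transpose]
    change Matrix.det _ = Matrix.det _
    congr 1
    ext j i
    simp [Matrix.transpose_apply, mul_comm]

/-- The exponents of the alternant of a partition, in increasing order. -/
def alternantExp (la : YoungDiagram) (n : ℕ) (j : Fin n) : ℕ := la.rowLen (n - 1 - j) + j

/-- A horizontal strip is the interlacing `λ_{i+1} ≤ ν_i ≤ λ_i`. After adding the staircase it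
becomes `m_j ≤ r_j < m_{j+1}`, the exponent ranges of the geometric sums in `det_pow_succ`. -/
theorem sum_horizontalStrips_alternant {R : Type*} [CommRing R] {n : ℕ} {la : YoungDiagram}
    [DecidablePred fun nu : YoungDiagram => nu.colLen 0 ≤ n]
    (hla : la.colLen 0 ≤ n + 1) (z : R) (F : (Fin n → ℕ) → R) :
    ∑ nu ∈ (horizontalStrips la).filter (fun nu => nu.colLen 0 ≤ n),
      z ^ (la.cells \ nu.cells).card * F (alternantExp nu n) =
    z ^ alternantExp la (n + 1) 0 *
      ∑ r ∈ Fintype.piFinset (fun j : Fin n => Finset.Ico (alternantExp la (n + 1) j.castSucc)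
        (alternantExp la (n + 1) j.succ)),
        (∏ j : Fin n, z ^ (alternantExp la (n + 1) j.succ - 1 - r j)) * F r := by
  have hl := YoungDiagram.colLen_zero_le_iff.1 hla
  have hcs : ∀ j : Fin n, alternantExp la (n + 1) j.castSucc = la.rowLen (n - 1 - j + 1) + j := by
    intro j
    simp only [alternantExp, Fin.val_castSucc]
    congr 2
    omega
  have hs : ∀ j : Fin n, alternantExp la (n + 1) j.succ = la.rowLen (n - 1 - j) + (j + 1) := by
    intro j
    simp only [alternantExp, Fin.val_succ]
    congr 2
    omega
  rw [Finset.mul_sum]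
  refine Finset.sum_bij (fun nu _ => alternantExp nu n) ?_ ?_ ?_ ?_
  · intro nu hnu
    rw [Finset.mem_filter, mem_horizontalStrips, isHorizontalStrip_iff_rowLen,
      YoungDiagram.le_iff_rowLen] at hnu
    rw [Fintype.mem_piFinset]
    intro j
    rw [Finset.mem_Ico, hcs, hs, alternantExp]
    have h1 := hnu.1.1 (n - 1 - j)
    have h2 := hnu.1.2 (n - 1 - j)
    omega
  · intro nu hnu nu' hnu' heq
    simp only [Finset.mem_filter] at hnu hnu'
    refine YoungDiagram.ext_rowLen fun i => ?_
    by_cases hi : i < n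
    · have := congrFun heq ⟨n - 1 - i, by omega⟩
      simp only [alternantExp] at this
      rwa [show n - 1 - (n - 1 - i) = i by omega, add_left_inj] at this
    · rw [YoungDiagram.colLen_zero_le_iff.1 hnu.2 i (by omega),
        YoungDiagram.colLen_zero_le_iff.1 hnu'.2 i (by omega)]
  · intro r hr
    rw [Fintype.mem_piFinset] at hr
    simp only [Finset.mem_Ico, hcs, hs] at hr
    set f : ℕ → ℕ := fun i => if h : i < n then r ⟨n - 1 - i, by omega⟩ - (n - 1 - i) else 0
      with hf
    have hf0 : ∀ i, n ≤ i → f i = 0 := fun i hi => by simp [hf, hi.not_gt]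
    have hfi : ∀ i (hi : i < n), f i + (n - 1 - i) = r ⟨n - 1 - i, by omega⟩ := by
      intro i hi
      have h1 := (hr ⟨n - 1 - i, by omega⟩).1
      simp only at h1
      simp only [hf, hi, dif_pos]
      omega
    have hlo : ∀ i, i < n → la.rowLen (i + 1) ≤ f i := by
      intro i hi
      have h1 := (hr ⟨n - 1 - i, by omega⟩).1
      simp only [show n - 1 - (n - 1 - i) = i by omega] at h1
      have := hfi i hi
      omega
    have hhi : ∀ i, i < n → f i ≤ la.rowLen i := by
      intro i hi
      have h1 := (hr ⟨n - 1 - i, by omega⟩).2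
      simp only [show n - 1 - (n - 1 - i) = i by omega] at h1
      have := hfi i hi
      omega
    have hanti : Antitone f := by
      refine antitone_nat_of_succ_le fun i => ?_
      by_cases hi : i + 1 < n
      · exact (hhi (i + 1) hi).trans (hlo i (by omega))
      · rw [hf0 (i + 1) (by omega)]
        exact Nat.zero_le _
    have hrow := YoungDiagram.rowLen_ofAntitone hanti hf0
    refine ⟨YoungDiagram.ofAntitone f hanti n, ?_, ?_⟩
    · rw [Finset.mem_filter, mem_horizontalStrips, isHorizontalStrip_iff_rowLen,
        YoungDiagram.le_iff_rowLen, YoungDiagram.colLen_zero_le_iff]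
      refine ⟨⟨fun i => ?_, fun i => ?_⟩, fun i hi => ?_⟩
      · rw [hrow]
        by_cases hi : i < n
        · exact hhi i hi
        · rw [hf0 i (by omega)]
          exact Nat.zero_le _
      · rw [hrow]
        by_cases hi : i < n
        · exact hlo i hi
        · rw [hl (i + 1) (by omega)]
          exact Nat.zero_le _
      · rw [hrow, hf0 i hi]
    · funext j
      simp only [alternantExp]
      rw [hrow]
      have h1 := hfi (n - 1 - j) (by omega)
      simp only [show n - 1 - (n - 1 - (j : ℕ)) = j by omega] at h1
      exact h1
  · intro nu hnu
    rw [Finset.mem_filter] at hnu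
    have h0 := YoungDiagram.colLen_zero_le_iff.1 hnu.2 n le_rfl
    rw [← mul_assoc]
    congr 1
    rw [YoungDiagram.card_sdiff_cells hla, Fin.sum_univ_castSucc, Finset.prod_pow_eq_pow_sum,
      ← pow_add, add_comm]
    congr 1
    simp only [hs]
    simp only [alternantExp, Fin.val_last, Fin.val_castSucc, h0, Fin.val_zero]
    congr 1
    -- Exponents increase while parts decrease, so row `i` belongs to exponent index `n - 1 - i`.
    rw [← Equiv.sum_comp Fin.revPerm]
    refine Finset.sum_congr rfl fun j _ => ?_
    simp only [Fin.revPerm_apply, Fin.val_rev]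
    rw [show n - (j + 1) = n - 1 - j by omega]
    omega

/-- The bialternant formula for Schur polynomials. -/
theorem skewSchurEval_bot_mul_vandermonde {R : Type*} [CommRing R] {n : ℕ} (x : Fin n → R)
    {la : YoungDiagram} (hla : la.colLen 0 ≤ n) :
    skewSchurEval la ⊥ x * (Matrix.vandermonde x).det =
      Matrix.det (Matrix.of fun i j => x i ^ alternantExp la n j) := by
  classical
  induction n generalizing la with
  | zero =>
    have : la = ⊥ := by
      refine YoungDiagram.ext_rowLen fun i => ?_
      rw [YoungDiagram.colLen_zero_le_iff.1 hla i (Nat.zero_le _)]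
      by_contra h
      exact YoungDiagram.notMem_bot _
        (YoungDiagram.mem_iff_lt_rowLen.2 (Nat.pos_of_ne_zero (Ne.symm h)))
    rw [skewSchurEval_zero, if_pos this]
    simp
  | succ n ih =>
    have hm : ∀ j : Fin n, alternantExp la (n + 1) j.castSucc ≤ alternantExp la (n + 1) j.succ := by
      intro j
      simp only [alternantExp, Fin.val_castSucc, Fin.val_succ]
      have := la.rowLen_anti (n + 1 - 1 - (j + 1)) (n + 1 - 1 - j) (by omega)
      omega
    rw [det_pow_succ x hm, det_vandermonde_succ_last, skewSchurEval_succ,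
      det_sum_pow (fun i : Fin n => x i.castSucc) (x (Fin.last n)) (fun j : Fin n =>
        Finset.Ico (alternantExp la (n + 1) j.castSucc) (alternantExp la (n + 1) j.succ))
        (fun j => alternantExp la (n + 1) j.succ - 1)]
    have h := sum_horizontalStrips_alternant hla (x (Fin.last n))
      (fun r => Matrix.det (Matrix.of fun i j : Fin n => x i.castSucc ^ r j))
    rw [mul_right_comm _ (x (Fin.last n) ^ _), mul_assoc _ (x (Fin.last n) ^ _), ← h,
      mul_left_comm]
    congr 1
    -- Diagrams with more than `n` rows have zero Schur polynomial in the remaining `n` variables.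
    rw [Finset.sum_mul, ← Finset.sum_filter_of_ne (p := fun nu => nu.colLen 0 ≤ n)]
    · refine Finset.sum_congr rfl fun nu hnu => ?_
      rw [mul_assoc, ih _ (Finset.mem_filter.1 hnu).2]
    · intro nu _ hne
      by_contra hn
      rw [skewSchurEval_bot_eq_zero _ (not_le.1 hn)] at hne
      simp at hne

/-! ### Generalized binomial coefficients -/

/-- The binomial coefficient with integer lower index, zero for a negative index. -/
noncomputable def intChoose (x : ℝ) (n : ℤ) : ℝ := if 0 ≤ n then Ring.choose x n.toNat else 0

theorem intChoose_natCast (x : ℝ) (n : ℕ) : intChoose x n = Ring.choose x n := by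
  simp [intChoose]

theorem intChoose_of_neg (x : ℝ) {n : ℤ} (hn : n < 0) : intChoose x n = 0 := by
  simp [intChoose, hn.not_ge]

theorem intChoose_zero (n : ℤ) : intChoose 0 n = if n = 0 then 1 else 0 := by
  rcases lt_or_ge n 0 with h | h
  · rw [intChoose_of_neg _ h, if_neg h.ne]
  · obtain ⟨k, rfl⟩ := Int.eq_ofNat_of_zero_le h
    rw [intChoose_natCast, Ring.choose_zero_ite]
    simp

theorem intChoose_add_one (x : ℝ) (n : ℤ) :
    intChoose (x + 1) n = intChoose x (n - 1) + intChoose x n := by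
  rcases lt_trichotomy n 0 with h | rfl | h
  · rw [intChoose_of_neg _ h, intChoose_of_neg _ h, intChoose_of_neg _ (by omega), add_zero]
  · rw [intChoose_of_neg x (show (0 : ℤ) - 1 < 0 by omega)]
    simp [intChoose]
  · obtain ⟨k, rfl⟩ : ∃ k : ℕ, n = (k + 1 : ℕ) := ⟨(n - 1).toNat, by omega⟩
    rw [show (((k + 1 : ℕ) : ℤ) - 1) = (k : ℕ) by push_cast; ring]
    simp only [intChoose_natCast]
    exact Ring.choose_succ_succ x k

/-- Pascal's rule in the third factor splits off the sum with `a`, `b` lowered; Pascal's rule in the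
first factor splits the rest. -/
theorem sum_intChoose_succ (g d : ℝ) (a : ℤ) (b : ℕ) :
    ∑ r ∈ Finset.range (b + 2), intChoose (g + 1) (a - r) * Ring.choose d (b + 1 - r) *
        Ring.choose (g + 1 + d + r) r =
      (∑ r ∈ Finset.range (b + 1), intChoose (g + 1) (a - 1 - r) * Ring.choose d (b - r) *
        Ring.choose (g + 1 + d + r) r) +
      ((∑ r ∈ Finset.range (b + 2), intChoose g (a - r) * Ring.choose d (b + 1 - r) *
        Ring.choose (g + d + r) r) +
      ∑ r ∈ Finset.range (b + 2), intChoose g (a - 1 - r) * Ring.choose d (b + 1 - r) *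
        Ring.choose (g + d + r) r) := by
  have h1 : (∑ r ∈ Finset.range (b + 2), intChoose g (a - r) * Ring.choose d (b + 1 - r) *
        Ring.choose (g + d + r) r) +
      ∑ r ∈ Finset.range (b + 2), intChoose g (a - 1 - r) * Ring.choose d (b + 1 - r) *
        Ring.choose (g + d + r) r =
      ∑ r ∈ Finset.range (b + 2), intChoose (g + 1) (a - r) * Ring.choose d (b + 1 - r) *
        Ring.choose (g + d + r) r := by
    rw [← Finset.sum_add_distrib]
    refine Finset.sum_congr rfl fun r _ => ?_
    rw [intChoose_add_one, sub_right_comm]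
    ring
  rw [h1, Finset.sum_range_succ', Finset.sum_range_succ' _ (b + 1), ← add_assoc,
    ← Finset.sum_add_distrib]
  congr 1
  · refine Finset.sum_congr rfl fun r _ => ?_
    rw [show g + 1 + d + ((r + 1 : ℕ) : ℝ) = (g + 1 + d + r) + 1 by push_cast; ring,
      Ring.choose_succ_succ, show a - ((r + 1 : ℕ) : ℤ) = a - 1 - r by push_cast; ring,
      show g + d + ((r + 1 : ℕ) : ℝ) = g + 1 + d + r by push_cast; ring, Nat.add_sub_add_right]
    ring
  · simp

/-- Only `r = a` survives, and the claim becomes trinomial revision. -/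
theorem sum_intChoose_zero (d : ℝ) (a : ℤ) (b : ℕ) :
    ∑ r ∈ Finset.range (b + 1), intChoose 0 (a - r) * Ring.choose d (b - r) *
        Ring.choose (d + r) r = intChoose b a * Ring.choose (d + a) b := by
  simp only [intChoose_zero, ite_mul, one_mul, zero_mul]
  rcases lt_or_ge a 0 with h | h
  · rw [intChoose_of_neg _ h, zero_mul]
    exact Finset.sum_eq_zero fun r _ => if_neg (by omega)
  · obtain ⟨n, rfl⟩ := Int.eq_ofNat_of_zero_le h
    rw [intChoose_natCast, Ring.choose_natCast]
    by_cases hn : n ≤ b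
    · rw [Finset.sum_eq_single n]
      · have := Ring.choose_smul_choose (d + n) hn
        rw [nsmul_eq_mul, add_sub_cancel_right] at this
        rw [if_pos (by omega)]
        push_cast
        rw [this, mul_comm]
      · intro r _ hr
        exact if_neg (by omega)
      · intro h
        exact absurd (Finset.mem_range.2 (by omega)) h
    · rw [Nat.choose_eq_zero_of_lt (by omega), Nat.cast_zero, zero_mul]
      refine Finset.sum_eq_zero fun r hr => if_neg ?_
      have := Finset.mem_range.1 hr
      omega

/-- By Pascal's rule applied twice, the right-hand side satisfies the recurrence of
`sum_intChoose_succ`. -/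
theorem sum_intChoose_natCast (d : ℝ) (b : ℕ) : ∀ (g : ℕ) (a : ℤ),
    ∑ r ∈ Finset.range (b + 1), intChoose g (a - r) * Ring.choose d (b - r) *
        Ring.choose (g + d + r) r = intChoose (g + b) a * Ring.choose (d + a) b := by
  induction b with
  | zero => simp
  | succ b ihb =>
    intro g
    induction g with
    | zero =>
      intro a
      simpa using sum_intChoose_zero d a (b + 1)
    | succ g ihg =>
      intro a
      have h1 := ihb (g + 1) (a - 1)
      have h2 := ihg a
      have h3 := ihg (a - 1)
      push_cast at h1 h2 h3 ⊢
      have h4 := sum_intChoose_succ g d a b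
      rw [h1, h2, h3, show (g : ℝ) + (b + 1) = g + 1 + b by ring] at h4
      have hA := intChoose_add_one (g + 1 + b) a
      have hB := Ring.choose_succ_succ (d + (a - 1)) b
      rw [show d + ((a : ℝ) - 1) + 1 = d + a by ring] at hB
      rw [add_assoc ((g : ℝ) + 1)] at hA
      rw [h4, hA, hB]
      ring

/-- A real function that is given by a polynomial. -/
def IsPolyFun (f : ℝ → ℝ) : Prop := ∃ p : Polynomial ℝ, ∀ x, f x = p.eval x

theorem IsPolyFun.mul {f g : ℝ → ℝ} (hf : IsPolyFun f) (hg : IsPolyFun g) :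
    IsPolyFun fun x => f x * g x := by
  obtain ⟨p, hp⟩ := hf
  obtain ⟨q, hq⟩ := hg
  exact ⟨p * q, fun x => by simp [hp, hq]⟩

theorem IsPolyFun.sum {ι : Type*} (s : Finset ι) {f : ι → ℝ → ℝ} (hf : ∀ i, IsPolyFun (f i)) :
    IsPolyFun fun x => ∑ i ∈ s, f i x := by
  choose p hp using hf
  exact ⟨∑ i ∈ s, p i, fun x => by simp [Polynomial.eval_finsetSum, hp]⟩

theorem IsPolyFun.const (c : ℝ) : IsPolyFun fun _ => c := ⟨Polynomial.C c, fun x => by simp⟩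

theorem isPolyFun_choose (c : ℝ) (n : ℕ) : IsPolyFun fun x => Ring.choose (x + c) n := by
  refine ⟨Polynomial.C ((n.factorial : ℝ)⁻¹) *
    ((ascPochhammer ℝ n).comp (Polynomial.X + Polynomial.C (c - n + 1))), fun x => ?_⟩
  simp only [Ring.choose_eq_smul, Polynomial.descPochhammer_smeval_eq_ascPochhammer,
    Polynomial.ascPochhammer_smeval_cast, Polynomial.ascPochhammer_smeval_eq_eval, smul_eq_mul,
    Polynomial.eval_mul, Polynomial.eval_C, Polynomial.eval_comp, Polynomial.eval_add,
    Polynomial.eval_X]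
  rw [show x + c - n + 1 = x + (c - n + 1) by ring]

theorem isPolyFun_intChoose (c : ℝ) (n : ℤ) : IsPolyFun fun x => intChoose (x + c) n := by
  unfold intChoose
  split_ifs
  · exact isPolyFun_choose c _
  · exact IsPolyFun.const 0

theorem IsPolyFun.eq_of_natCast {f g : ℝ → ℝ} (hf : IsPolyFun f) (hg : IsPolyFun g)
    (h : ∀ n : ℕ, f n = g n) (x : ℝ) : f x = g x := by
  obtain ⟨p, hp⟩ := hf
  obtain ⟨q, hq⟩ := hg
  have : p = q := by
    refine Polynomial.eq_of_infinite_eval_eq p q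
      ((Set.infinite_range_of_injective (Nat.cast_injective (R := ℝ))).mono ?_)
    rintro _ ⟨n, rfl⟩
    change p.eval _ = q.eval _
    rw [← hp, ← hq, h]
  rw [hp, hq, this]

/-- Both sides are polynomials in `g` that agree at all natural numbers. This Saalschütz-type
identity is the source of the LU factorization of the Toeplitz matrix. -/
theorem sum_intChoose (g d : ℝ) (a : ℤ) (b : ℕ) :
    ∑ r ∈ Finset.range (b + 1), intChoose g (a - r) * Ring.choose d (b - r) *
        Ring.choose (g + d + r) r = intChoose (g + b) a * Ring.choose (d + a) b := by
  refine IsPolyFun.eq_of_natCast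
    (f := fun g => ∑ r ∈ Finset.range (b + 1), intChoose g (a - r) * Ring.choose d (b - r) *
        Ring.choose (g + d + r) r)
    (g := fun g => intChoose (g + b) a * Ring.choose (d + a) b) ?_ ?_ ?_ g
  · refine IsPolyFun.sum _ fun r => ((?_ : IsPolyFun _).mul (IsPolyFun.const _)).mul ?_
    · simpa using isPolyFun_intChoose 0 (a - r)
    · simpa only [add_assoc] using isPolyFun_choose (d + r) r
  · exact (isPolyFun_intChoose b a).mul (IsPolyFun.const _)
  · exact fun n => sum_intChoose_natCast d b n a

theorem intChoose_neg (x : ℝ) (r k : ℕ) :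
    intChoose (-x) ((r : ℤ) - k) =
      if k ≤ r then (-1) ^ (r + k) * Ring.choose (x + r - k - 1) (r - k) else 0 := by
  split_ifs with h
  · obtain ⟨m, rfl⟩ := Nat.exists_eq_add_of_le h
    rw [show ((k + m : ℕ) : ℤ) - k = m by push_cast; ring, intChoose_natCast, Ring.choose_neg,
      Nat.add_sub_cancel_left, show k + m + k = 2 * k + m by ring, pow_add, pow_mul,
      show x + ((k + m : ℕ) : ℝ) - k - 1 = x + m - 1 by push_cast; ring]
    simp [Units.smul_def]
  · exact intChoose_of_neg _ (by omega)

/-- Compare coefficients in `(1+t)^x (1+t)^{-x} = 1`. It inverts the triangular factors. -/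
theorem sum_intChoose_mul_neg (x : ℝ) {a k K : ℕ} (ha : a < K) :
    ∑ r ∈ Finset.range K, intChoose x ((a : ℤ) - r) * intChoose (-x) ((r : ℤ) - k) =
      if a = k then 1 else 0 := by
  by_cases hk : k ≤ a
  · have h := Ring.add_choose_eq (r := x) (s := -x) (a - k) (Commute.all _ _)
    rw [add_neg_cancel, Ring.choose_zero_ite] at h
    rw [if_congr (show a = k ↔ a - k = 0 by omega) rfl rfl, h]
    symm
    refine Finset.sum_of_injOn (fun p => p.2 + k) ?_ ?_ ?_ ?_
    · rintro ⟨i, j⟩ h1 ⟨i', j'⟩ h2 h3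
      simp only [Finset.mem_coe, Finset.HasAntidiagonal.mem_antidiagonal] at h1 h2 h3
      ext <;> simp only <;> omega
    · rintro ⟨i, j⟩ h1
      simp only [Finset.mem_coe, Finset.HasAntidiagonal.mem_antidiagonal, Finset.mem_range] at h1 ⊢
      omega
    · intro r _ hr
      rcases lt_or_ge r k with h1 | h1
      · rw [intChoose_of_neg (-x) (by omega), mul_zero]
      · rcases lt_or_ge a r with h2 | h2
        · rw [intChoose_of_neg x (by omega), zero_mul]
        · refine absurd ⟨(a - r, r - k), ?_, ?_⟩ hr
          · simp only [Finset.mem_coe, Finset.HasAntidiagonal.mem_antidiagonal]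
            omega
          · simp only
            omega
    · rintro ⟨i, j⟩ h1
      simp only [Finset.HasAntidiagonal.mem_antidiagonal] at h1 ⊢
      rw [← intChoose_natCast, ← intChoose_natCast]
      congr 2 <;> omega
  · rw [if_neg (by omega)]
    refine Finset.sum_eq_zero fun r _ => ?_
    rcases lt_or_ge a r with h2 | h2
    · rw [intChoose_of_neg x (by omega), zero_mul]
    · rw [intChoose_of_neg (-x) (by omega), mul_zero]

/-- `Real.Gamma` is 0 at its poles, so its inverse agrees with the entire function `1/Γ` everywhere.
Out-of-range binomials and Fourier coefficients therefore vanish automatically in the formulas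
below. -/
theorem Real.inv_Gamma_eq_mul (x : ℝ) : (Real.Gamma x)⁻¹ = x * (Real.Gamma (x + 1))⁻¹ := by
  by_cases hx : x = 0
  · simp [hx, Real.Gamma_zero]
  · rw [Real.Gamma_add_one hx, mul_inv, mul_inv_cancel_left₀ hx]

theorem choose_eq_Gamma {x : ℝ} (hx : 0 ≤ x) (n : ℕ) :
    Ring.choose x n = Real.Gamma (x + 1) * ((n.factorial : ℝ)⁻¹ * (Real.Gamma (x - n + 1))⁻¹) := by
  have h0 : Real.Gamma (x + 1) ≠ 0 := (Real.Gamma_pos_of_pos (by linarith)).ne'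
  induction n with
  | zero => simp [h0]
  | succ n ih =>
    have h := Ring.choose_smul_choose x (Nat.le_succ n)
    rw [Nat.succ_sub (le_refl n), Nat.sub_self, Ring.choose_one_right, nsmul_eq_mul,
      Nat.choose_succ_self_right, ih] at h
    have h1 := Real.inv_Gamma_eq_mul (x - n)
    have h2 : ((n + 1 : ℕ) : ℝ) ≠ 0 := Nat.cast_ne_zero.2 (Nat.succ_ne_zero n)
    refine mul_left_cancel₀ h2 (h.trans ?_)
    rw [Nat.factorial_succ, show x - ((n + 1 : ℕ) : ℝ) + 1 = x - n by push_cast; ring, h1]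
    push_cast at h2 ⊢
    field_simp

/-! ### The Toeplitz matrix of a pure Fisher–Hartwig symbol -/

/-- The Fourier coefficients of the pure Fisher–Hartwig symbol. -/
noncomputable def fhCoeff (g d : ℝ) (n : ℤ) : ℝ :=
  Real.Gamma (g + d + 1) / (Real.Gamma (g - n + 1) * Real.Gamma (d + n + 1))

/-- Up to a constant and factors depending on `a` alone or on `b` alone, the coefficient is
`binom(g+b, a) binom(d+a, b)`, which `sum_intChoose` expands into products of a term in `a, r` and a
term in `b, r`. -/
theorem fhCoeff_eq_sum {g d : ℝ} (hg : 0 ≤ g) (hd : 0 ≤ d) (a b : ℕ) :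
    fhCoeff g d ((a : ℤ) - b) =
      (a.factorial / Real.Gamma (d + a + 1)) * (b.factorial / Real.Gamma (g + b + 1)) *
      ∑ r ∈ Finset.range (b + 1), intChoose g ((a : ℤ) - r) * intChoose d ((b : ℤ) - r) *
        (Real.Gamma (g + d + r + 1) / r.factorial) := by
  have h := sum_intChoose g d a b
  rw [intChoose_natCast, Int.cast_natCast, choose_eq_Gamma (x := g + b) (by positivity),
    choose_eq_Gamma (x := d + a) (by positivity)] at h
  have hM : Real.Gamma (g + d + 1) ≠ 0 := (Real.Gamma_pos_of_pos (by positivity)).ne'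
  have h1 : Real.Gamma (d + a + 1) ≠ 0 := (Real.Gamma_pos_of_pos (by positivity)).ne'
  have h2 : Real.Gamma (g + b + 1) ≠ 0 := (Real.Gamma_pos_of_pos (by positivity)).ne'
  have h3 : (a.factorial : ℝ) ≠ 0 := Nat.cast_ne_zero.2 a.factorial_ne_zero
  have h4 : (b.factorial : ℝ) ≠ 0 := Nat.cast_ne_zero.2 b.factorial_ne_zero
  have hsum : ∑ r ∈ Finset.range (b + 1), intChoose g ((a : ℤ) - r) * intChoose d ((b : ℤ) - r) *
        (Real.Gamma (g + d + r + 1) / r.factorial) = Real.Gamma (g + d + 1) *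
      ∑ r ∈ Finset.range (b + 1), intChoose g ((a : ℤ) - r) * Ring.choose d (b - r) *
        Ring.choose (g + d + r) r := by
    rw [Finset.mul_sum]
    refine Finset.sum_congr rfl fun r hr => ?_
    have hr := Finset.mem_range.1 hr
    rw [choose_eq_Gamma (x := g + d + r) (by positivity), ← Nat.cast_sub (show r ≤ b by omega),
      intChoose_natCast, add_sub_cancel_right]
    field_simp
  rw [hsum, h, fhCoeff]
  push_cast
  rw [show g + (b : ℝ) - a + 1 = g - (a - b) + 1 by ring,
    show d + (a : ℝ) - b + 1 = d + (a - b) + 1 by ring, div_eq_mul_inv, mul_inv]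
  field_simp

/-- The Toeplitz matrix of the pure Fisher–Hartwig symbol. -/
noncomputable def fhMatrix (g d : ℝ) (N : ℕ) : Matrix (Fin (N + 1)) (Fin (N + 1)) ℝ :=
  Matrix.of fun a b => fhCoeff g d ((a : ℤ) - b)

/-- The lower triangular factor. -/
noncomputable def fhLower (g d : ℝ) (N : ℕ) : Matrix (Fin (N + 1)) (Fin (N + 1)) ℝ :=
  Matrix.of fun a r => ((a : ℕ).factorial / Real.Gamma (d + a + 1)) *
    intChoose g ((a : ℤ) - r) * (Real.Gamma (g + d + r + 1) / (r : ℕ).factorial)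

/-- The upper triangular factor. -/
noncomputable def fhUpper (g d : ℝ) (N : ℕ) : Matrix (Fin (N + 1)) (Fin (N + 1)) ℝ :=
  Matrix.of fun r b => ((b : ℕ).factorial / Real.Gamma (g + b + 1)) * intChoose d ((b : ℤ) - r)

/-- The inverse of the lower triangular factor. -/
noncomputable def fhLowerInv (g d : ℝ) (N : ℕ) : Matrix (Fin (N + 1)) (Fin (N + 1)) ℝ :=
  Matrix.of fun r k => ((r : ℕ).factorial / Real.Gamma (g + d + r + 1)) *
    intChoose (-g) ((r : ℤ) - k) * (Real.Gamma (d + k + 1) / (k : ℕ).factorial)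

/-- The inverse of the upper triangular factor. -/
noncomputable def fhUpperInv (g d : ℝ) (N : ℕ) : Matrix (Fin (N + 1)) (Fin (N + 1)) ℝ :=
  Matrix.of fun j r => (Real.Gamma (g + j + 1) / (j : ℕ).factorial) * intChoose (-d) ((r : ℤ) - j)

theorem fhMatrix_eq_mul {g d : ℝ} (hg : 0 ≤ g) (hd : 0 ≤ d) (N : ℕ) :
    fhMatrix g d N = fhLower g d N * fhUpper g d N := by
  ext a b
  rw [fhMatrix, Matrix.of_apply, fhCoeff_eq_sum hg hd, Matrix.mul_apply, Finset.mul_sum]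
  simp only [fhLower, fhUpper, Matrix.of_apply]
  rw [Fin.sum_univ_eq_sum_range (fun r => ((a : ℕ).factorial / Real.Gamma (d + a + 1)) *
    intChoose g ((a : ℤ) - r) * (Real.Gamma (g + d + r + 1) / (r : ℕ).factorial) *
    (((b : ℕ).factorial / Real.Gamma (g + b + 1)) * intChoose d ((b : ℤ) - r)))]
  refine (Finset.sum_congr rfl fun r _ => by ring).trans
    (Finset.sum_subset (Finset.range_subset_range.2 (by omega)) fun r _ hr => ?_)
  rw [Finset.mem_range, not_lt] at hr
  rw [intChoose_of_neg d (by omega)]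
  ring

theorem fhLower_mul_inv {g d : ℝ} (hg : 0 ≤ g) (hd : 0 ≤ d) (N : ℕ) :
    fhLower g d N * fhLowerInv g d N = 1 := by
  ext a k
  have h := sum_intChoose_mul_neg g (k := k) a.2
  rw [← Fin.sum_univ_eq_sum_range
    (fun r => intChoose g ((a : ℤ) - r) * intChoose (-g) ((r : ℤ) - k))] at h
  have h1 : ∀ r : Fin (N + 1), Real.Gamma (g + d + r + 1) ≠ 0 := fun r =>
    (Real.Gamma_pos_of_pos (by positivity)).ne'
  have h2 : ∀ r : Fin (N + 1), ((r : ℕ).factorial : ℝ) ≠ 0 := fun r =>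
    Nat.cast_ne_zero.2 (Nat.factorial_ne_zero _)
  have h3 : Real.Gamma (d + a + 1) ≠ 0 := (Real.Gamma_pos_of_pos (by positivity)).ne'
  have h4 : (fhLower g d N * fhLowerInv g d N) a k =
      ((a : ℕ).factorial / Real.Gamma (d + a + 1)) * (Real.Gamma (d + k + 1) / (k : ℕ).factorial) *
        ∑ r : Fin (N + 1), intChoose g ((a : ℤ) - r) * intChoose (-g) ((r : ℤ) - k) := by
    rw [Matrix.mul_apply, Finset.mul_sum]
    refine Finset.sum_congr rfl fun r _ => ?_
    simp only [fhLower, fhLowerInv, Matrix.of_apply]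
    have := h1 r
    have := h2 r
    field_simp
  rw [h4, h, Matrix.one_apply]
  have h5 := h2 a
  by_cases hak : a = k
  · subst hak
    simp only [if_true]
    field_simp
  · rw [if_neg (fun h => hak (Fin.ext h)), if_neg hak, mul_zero]

theorem fhUpper_mul_inv {g : ℝ} (hg : 0 ≤ g) (d : ℝ) (N : ℕ) :
    fhUpper g d N * fhUpperInv g d N = 1 := by
  ext a k
  have h1 : ∀ r : Fin (N + 1), Real.Gamma (g + r + 1) ≠ 0 := fun r =>
    (Real.Gamma_pos_of_pos (by positivity)).ne'
  have h2 : ∀ r : Fin (N + 1), ((r : ℕ).factorial : ℝ) ≠ 0 := fun r =>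
    Nat.cast_ne_zero.2 (Nat.factorial_ne_zero _)
  have h' := sum_intChoose_mul_neg (-d) (k := a) k.2
  rw [← Fin.sum_univ_eq_sum_range
    (fun r => intChoose (-d) ((k : ℤ) - r) * intChoose (- -d) ((r : ℤ) - a)), neg_neg] at h'
  have h4 : (fhUpper g d N * fhUpperInv g d N) a k =
        ∑ r : Fin (N + 1), intChoose (-d) ((k : ℤ) - r) * intChoose d ((r : ℤ) - a) := by
    rw [Matrix.mul_apply]
    refine Finset.sum_congr rfl fun r _ => ?_
    simp only [fhUpper, fhUpperInv, Matrix.of_apply]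
    have := h1 r
    have := h2 r
    field_simp
  rw [h4, h', Matrix.one_apply]
  exact if_congr (by rw [Fin.ext_iff, eq_comm]) rfl rfl

theorem det_fhMatrix {g d : ℝ} (hg : 0 ≤ g) (hd : 0 ≤ d) (N : ℕ) :
    (fhMatrix g d N).det = ∏ r ∈ Finset.range (N + 1),
      (r.factorial * Real.Gamma (g + d + r + 1) /
        (Real.Gamma (g + r + 1) * Real.Gamma (d + r + 1))) := by
  have hL : (fhLower g d N).det = ∏ r, fhLower g d N r r := by
    refine Matrix.det_of_isLowerTriangular _ fun a r h => ?_
    have h : (a : ℕ) < r := h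
    rw [fhLower, Matrix.of_apply, intChoose_of_neg g (by omega)]
    ring
  have hU : (fhUpper g d N).det = ∏ r, fhUpper g d N r r := by
    refine Matrix.det_of_isUpperTriangular fun a r h => ?_
    have h : (r : ℕ) < a := h
    rw [fhUpper, Matrix.of_apply, intChoose_of_neg d (by omega)]
    ring
  rw [fhMatrix_eq_mul hg hd, Matrix.det_mul, hL, hU, ← Finset.prod_mul_distrib,
    ← Fin.prod_univ_eq_prod_range (fun r => (r.factorial * Real.Gamma (g + d + r + 1) /
        (Real.Gamma (g + r + 1) * Real.Gamma (d + r + 1))))]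
  refine Finset.prod_congr rfl fun r _ => ?_
  have h2 : ((r : ℕ).factorial : ℝ) ≠ 0 := Nat.cast_ne_zero.2 (Nat.factorial_ne_zero _)
  have h0 : ∀ x, intChoose x 0 = 1 := fun x => by simp [intChoose]
  simp only [fhLower, fhUpper, Matrix.of_apply, sub_self, h0]
  field_simp

/-- Cramer's rule: the minor without row `k` and column `j` is, up to sign, the determinant times
the `(j, k)` entry of the inverse, computed as `U⁻¹ L⁻¹`. -/
theorem det_fhMatrix_minor {g d : ℝ} (hg : 0 ≤ g) (hd : 0 ≤ d) {N j k : ℕ} (hj : j < N + 1)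
    (hk : k < N + 1) :
    Matrix.det (Matrix.of fun a b : Fin N => fhCoeff g d
      ((((⟨k, hk⟩ : Fin (N + 1)).succAbove a : ℕ) : ℤ) -
        ((⟨j, hj⟩ : Fin (N + 1)).succAbove b : ℕ))) =
      (∏ r ∈ Finset.range (N + 1), (r.factorial * Real.Gamma (g + d + r + 1) /
        (Real.Gamma (g + r + 1) * Real.Gamma (d + r + 1)))) *
      (Real.Gamma (g + j + 1) / Real.Gamma (j + 1)) *
      (Real.Gamma (d + k + 1) / Real.Gamma (k + 1)) *
      ∑ r ∈ Finset.Icc (max j k) N, Real.Gamma (r + 1) / Real.Gamma (g + d + r + 1) *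
        Ring.choose (g + r - k - 1) (r - k) * Ring.choose (d + r - j - 1) (r - j) := by
  set T := fhMatrix g d N with hT
  have h1 : T * (fhUpperInv g d N * fhLowerInv g d N) = 1 := by
    rw [hT, fhMatrix_eq_mul hg hd, Matrix.mul_assoc, ← Matrix.mul_assoc (fhUpper g d N),
      fhUpper_mul_inv hg, Matrix.one_mul, fhLower_mul_inv hg hd]
  have h2 : T.adjugate = T.det • (fhUpperInv g d N * fhLowerInv g d N) := by
    rw [← Matrix.mul_one T.adjugate, ← h1, ← Matrix.mul_assoc, Matrix.adjugate_mul,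
      Matrix.smul_mul, Matrix.one_mul]
  have h3 := Matrix.adjugate_fin_succ_eq_det_submatrix T ⟨j, hj⟩ ⟨k, hk⟩
  rw [h2, Matrix.smul_apply, smul_eq_mul] at h3
  have h4 : Matrix.det (Matrix.of fun a b : Fin N => fhCoeff g d
      ((((⟨k, hk⟩ : Fin (N + 1)).succAbove a : ℕ) : ℤ) -
        ((⟨j, hj⟩ : Fin (N + 1)).succAbove b : ℕ))) =
      (-1) ^ (k + j) * (T.det * (fhUpperInv g d N * fhLowerInv g d N) ⟨j, hj⟩ ⟨k, hk⟩) := by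
    rw [h3, ← mul_assoc, ← pow_add, ← two_mul, pow_mul, neg_one_sq, one_pow, one_mul]
    rfl
  rw [h4, hT, det_fhMatrix hg hd, mul_left_comm, mul_assoc, mul_assoc]
  congr 1
  rw [Matrix.mul_apply]
  simp only [fhUpperInv, fhLowerInv, Matrix.of_apply]
  rw [Fin.sum_univ_eq_sum_range (fun r => Real.Gamma (g + j + 1) / (j.factorial : ℝ) *
    intChoose (-d) ((r : ℤ) - j) * ((r.factorial : ℝ) / Real.Gamma (g + d + r + 1) *
    intChoose (-g) ((r : ℤ) - k) * (Real.Gamma (d + k + 1) / (k.factorial : ℝ)))),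
    Finset.mul_sum, Finset.mul_sum, Finset.mul_sum]
  symm
  have hsub : Finset.Icc (max j k) N ⊆ Finset.range (N + 1) := fun r hr => by
    rw [Finset.mem_Icc] at hr
    rw [Finset.mem_range]
    omega
  refine (Finset.sum_congr rfl fun r hr => ?_).trans (Finset.sum_subset hsub fun r hr hr' => ?_)
  · have hr := Finset.mem_Icc.1 hr
    rw [intChoose_neg, intChoose_neg, if_pos (by omega), if_pos (by omega),
      Real.Gamma_nat_eq_factorial, Real.Gamma_nat_eq_factorial, Real.Gamma_nat_eq_factorial]
    -- The cofactor sign cancels the signs of the two binomials with negated upper argument.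
    have h5 : (-1 : ℝ) ^ (k + j) * (-1) ^ (r + j) * (-1) ^ (r + k) = 1 := by
      rw [← pow_add, ← pow_add, show k + j + (r + j) + (r + k) = 2 * (k + j + r) by ring,
        pow_mul, neg_one_sq, one_pow]
    linear_combination (-(Real.Gamma (g + j + 1) / (j.factorial : ℝ) *
      ((r.factorial : ℝ) / Real.Gamma (g + d + r + 1)) *
      (Real.Gamma (d + k + 1) / (k.factorial : ℝ)) *
      Ring.choose (g + r - k - 1) (r - k) * Ring.choose (d + r - j - 1) (r - j))) * h5
  · rw [Finset.mem_range] at hr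
    rw [Finset.mem_Icc] at hr'
    rcases lt_or_ge r j with h | h
    · rw [intChoose_of_neg (-d) (by omega)]
      ring
    · rw [intChoose_of_neg (-g) (by omega)]
      ring

/-! ### The Barnes function -/

section Barnes

open Filter Topology

/-- The factors of the Weierstrass product of the Barnes function. -/
noncomputable def barnesFactor (z : ℝ) (n : ℕ) : ℝ :=
  (1 + z / (n + 1)) ^ (n + 1) * Real.exp (z ^ 2 / (2 * (n + 1)) - z)

theorem barnesFactor_pos {z : ℝ} (hz : 0 ≤ z) (n : ℕ) : 0 < barnesFactor z n := by
  unfold barnesFactor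
  positivity

theorem log_barnesFactor {z : ℝ} (hz : 0 ≤ z) (n : ℕ) : Real.log (barnesFactor z n) =
    (n + 1) * (Real.log (1 + z / (n + 1)) + (z / (n + 1)) ^ 2 / 2 - z / (n + 1)) := by
  have h1 : (0 : ℝ) < 1 + z / (n + 1) := by positivity
  rw [barnesFactor, Real.log_mul (by positivity) (Real.exp_pos _).ne', Real.log_exp, Real.log_pow]
  push_cast
  field_simp
  ring

/-- With `u = z/(n+1)`, the Taylor remainder of `log (1 + u)` after two terms is at most `u³/(1-u) ≤
2u³`, since `u ≤ 1/2`. The outer factor `n + 1` still leaves a summable bound. -/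
theorem abs_log_barnesFactor_le {z : ℝ} (hz : 0 ≤ z) {n : ℕ} (hn : 2 * z ≤ n + 1) :
    |Real.log (barnesFactor z n)| ≤ 2 * z ^ 3 * (1 / ((n : ℝ) + 1) ^ 2) := by
  have hn0 : (0 : ℝ) < n + 1 := by positivity
  set u := z / ((n : ℝ) + 1) with hu
  have hu0 : 0 ≤ u := by positivity
  have hu1 : u ≤ 1 / 2 := by
    rw [hu, div_le_iff₀ hn0]
    linarith
  have h := Real.abs_log_sub_add_sum_range_le (x := -u) (by rw [abs_neg, abs_of_nonneg hu0]; linarith) 2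
  rw [abs_neg, abs_of_nonneg hu0, Finset.sum_range_succ, Finset.sum_range_one] at h
  have h2 : u ^ (2 + 1) / (1 - u) ≤ 2 * u ^ 3 := by
    rw [div_le_iff₀ (by linarith)]
    have : 0 ≤ u ^ 3 * (1 - 2 * u) := mul_nonneg (by positivity) (by linarith)
    linear_combination this
  rw [log_barnesFactor hz, abs_mul, abs_of_pos hn0]
  have h3 : |Real.log (1 + u) + u ^ 2 / 2 - u| ≤ 2 * u ^ 3 := by
    refine le_trans (le_of_eq ?_) (h.trans h2)
    congr 1
    rw [sub_neg_eq_add]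
    push_cast
    ring
  calc ((n : ℝ) + 1) * |Real.log (1 + u) + u ^ 2 / 2 - u| ≤ ((n : ℝ) + 1) * (2 * u ^ 3) := by
        gcongr
    _ = 2 * z ^ 3 * (1 / ((n : ℝ) + 1) ^ 2) := by
        rw [hu]
        field_simp

theorem summable_log_barnesFactor {z : ℝ} (hz : 0 ≤ z) :
    Summable fun n => Real.log (barnesFactor z n) := by
  have hs : Summable fun n : ℕ => 2 * z ^ 3 * (1 / ((n : ℝ) + 1) ^ 2) := by
    refine Summable.mul_left _ ?_
    have := (summable_nat_add_iff 1).2 (Real.summable_one_div_nat_pow.2 (one_lt_two))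
    simpa using this
  refine Summable.of_norm_bounded_eventually_nat hs ?_
  obtain ⟨n₀, h0⟩ := exists_nat_ge (2 * z)
  filter_upwards [eventually_ge_atTop n₀] with n hn
  rw [Real.norm_eq_abs]
  have : (n₀ : ℝ) ≤ n := Nat.cast_le.2 hn
  exact abs_log_barnesFactor_le hz (by linarith)

/-- The factor in front of the Weierstrass product of the Barnes function. -/
noncomputable def barnesPrefactor (z : ℝ) : ℝ :=
  (2 * π) ^ (z / 2) * Real.exp (-(z + z ^ 2 * (1 + Real.eulerMascheroniConstant)) / 2)

theorem barnesPrefactor_pos (z : ℝ) : 0 < barnesPrefactor z := by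
  unfold barnesPrefactor
  positivity

theorem barnesG_add_one (z : ℝ) : barnesG (z + 1) = barnesPrefactor z * ∏' n, barnesFactor z n := by
  simp only [barnesG, barnesPrefactor, barnesFactor, add_sub_cancel_right]

theorem barnesG_one : barnesG 1 = 1 := by
  rw [← zero_add (1 : ℝ), barnesG_add_one]
  simp [barnesPrefactor, barnesFactor]

theorem barnesG_pos {x : ℝ} (hx : 1 ≤ x) : 0 < barnesG x := by
  obtain ⟨z, rfl⟩ : ∃ z, x = z + 1 := ⟨x - 1, by ring⟩
  have hz : 0 ≤ z := by linarith
  rw [barnesG_add_one, ← Real.rexp_tsum_eq_tprod (barnesFactor_pos hz) (summable_log_barnesFactor hz)]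
  have := barnesPrefactor_pos z
  positivity

theorem tendsto_prod_barnesFactor {z : ℝ} (hz : 0 ≤ z) :
    Tendsto (fun n => barnesPrefactor z * ∏ k ∈ Finset.range n, barnesFactor z k) atTop
      (𝓝 (barnesG (z + 1))) := by
  rw [barnesG_add_one]
  exact (Real.multipliable_of_summable_log (barnesFactor_pos hz)
    (summable_log_barnesFactor hz)).hasProd.tendsto_prod_nat.const_mul _

/-- The finite form of `G(x+1) = Γ(x) G(x)`: consecutive powers `(n + x)^n` telescope, and the
exponents accumulate into the harmonic number. -/
theorem prod_barnesFactor_mul (x : ℝ) (n : ℕ) :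
    (∏ k ∈ Finset.range n, barnesFactor x k) * ∏ j ∈ Finset.range n, (x + j) =
      (∏ k ∈ Finset.range n, barnesFactor (x - 1) k) * (n + x) ^ n *
        Real.exp ((x - 1 / 2) * harmonic n - n) := by
  induction n with
  | zero => simp
  | succ n ih =>
    have hn0 : (n : ℝ) + 1 ≠ 0 := by positivity
    have h1 : barnesFactor x n * (x + n) * (n + x) ^ n =
        barnesFactor (x - 1) n * ((n + 1 : ℕ) + x) ^ (n + 1) *
          Real.exp ((x - 1 / 2) * (n + 1 : ℝ)⁻¹ - 1) := by
      rw [barnesFactor, barnesFactor,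
        show x ^ 2 / (2 * ((n : ℝ) + 1)) - x = ((x - 1) ^ 2 / (2 * (n + 1)) - (x - 1)) +
          ((x - 1 / 2) * (n + 1 : ℝ)⁻¹ - 1) by field_simp; ring, Real.exp_add,
        show 1 + x / ((n : ℝ) + 1) = (n + 1 + x) / (n + 1) by field_simp,
        show 1 + (x - 1) / ((n : ℝ) + 1) = (n + x) / (n + 1) by field_simp; ring,
        div_pow, div_pow]
      push_cast
      ring
    rw [Finset.prod_range_succ, Finset.prod_range_succ, Finset.prod_range_succ, harmonic_succ]
    push_cast
    rw [show (x - 1 / 2) * ((harmonic n : ℝ) + (n + 1 : ℝ)⁻¹) - (n + 1) =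
      ((x - 1 / 2) * harmonic n - n) + ((x - 1 / 2) * (n + 1 : ℝ)⁻¹ - 1) by ring, Real.exp_add]
    push_cast at h1
    calc _ = barnesFactor x n * (x + n) * ((∏ k ∈ Finset.range n, barnesFactor x k) *
          ∏ j ∈ Finset.range n, (x + j)) := by ring
      _ = (∏ k ∈ Finset.range n, barnesFactor (x - 1) k) *
          Real.exp ((x - 1 / 2) * harmonic n - n) *
          (barnesFactor x n * (x + n) * (n + x) ^ n) := by rw [ih]; ring
      _ = _ := by rw [h1]; ring

/-- Regroups the finite identity into sequences with known limits: Euler's sequence for `Γ(x)`, `(1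
+ x/n)^n`, `H_n - log n` and the Stirling sequence. -/
theorem prod_barnesFactor_eq {x : ℝ} (hx : 0 < x) {n : ℕ} (hn : n ≠ 0) :
    ∏ k ∈ Finset.range n, barnesFactor x k =
      (∏ k ∈ Finset.range n, barnesFactor (x - 1) k) *
        (Real.GammaSeq x n * (1 + x / n) ^ n * (1 + x / n) *
          Real.exp ((x - 1 / 2) * (harmonic n - Real.log n)) *
          (Stirling.stirlingSeq n * √2)⁻¹) := by
  have hn0 : (0 : ℝ) < n := Nat.cast_pos.2 (Nat.pos_of_ne_zero hn)
  have hp : 0 < ∏ j ∈ Finset.range n, (x + j) := Finset.prod_pos fun j _ => by positivity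
  refine mul_right_cancel₀ hp.ne' ?_
  rw [prod_barnesFactor_mul, mul_assoc, mul_assoc]
  congr 1
  have hfac : (n.factorial : ℝ) ≠ 0 := Nat.cast_ne_zero.2 n.factorial_ne_zero
  have h1 : Real.GammaSeq x n * ∏ j ∈ Finset.range n, (x + j) =
      (n : ℝ) ^ x * n.factorial / (x + n) := by
    rw [Real.GammaSeq, Finset.prod_range_succ]
    field_simp
  have h2 : Real.exp ((x - 1 / 2) * (harmonic n - Real.log n)) =
      Real.exp ((x - 1 / 2) * harmonic n - n) * Real.exp n * (√n * ((n : ℝ) ^ x)⁻¹) := by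
    rw [Real.sqrt_eq_rpow, ← Real.rpow_neg hn0.le, ← Real.rpow_add hn0, Real.rpow_def_of_pos hn0,
      ← Real.exp_add, ← Real.exp_add]
    congr 1
    ring
  have h3 : (Stirling.stirlingSeq n * √2)⁻¹ = √n * (n : ℝ) ^ n * (Real.exp n)⁻¹ / n.factorial := by
    rw [Stirling.stirlingSeq, Real.sqrt_mul (by norm_num), div_pow, ← Real.exp_nat_mul, mul_one]
    field_simp
  have h4 : √(n : ℝ) * √n = n := Real.mul_self_sqrt hn0.le
  have h5 : (n : ℝ) ^ x ≠ 0 := (Real.rpow_pos_of_pos hn0 x).ne'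
  have h6 : (x + n) ≠ 0 := by positivity
  have h7 : 1 + x / (n : ℝ) = (n + x) / n := by field_simp
  calc (n + x) ^ n * Real.exp ((x - 1 / 2) * harmonic n - n)
      = (n + x) ^ n * Real.exp ((x - 1 / 2) * harmonic n - n) * (√(n : ℝ) * √n / n) := by
        rw [h4, div_self hn0.ne', mul_one]
    _ = (((n : ℝ) ^ x * n.factorial / (x + n)) * ((n + x) / n) ^ n * ((n + x) / n) *
        (Real.exp ((x - 1 / 2) * harmonic n - n) * Real.exp n * (√n * ((n : ℝ) ^ x)⁻¹)) *
        (√n * (n : ℝ) ^ n * (Real.exp n)⁻¹ / n.factorial)) := by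
        rw [div_pow, add_comm x]
        rw [add_comm x] at h6
        field_simp
    _ = _ := by rw [← h1, ← h2, ← h3, h7]; ring

theorem tendsto_barnes_ratio (x : ℝ) :
    Tendsto (fun n : ℕ => Real.GammaSeq x n * (1 + x / n) ^ n * (1 + x / n) *
          Real.exp ((x - 1 / 2) * (harmonic n - Real.log n)) *
          (Stirling.stirlingSeq n * √2)⁻¹) atTop
      (𝓝 (Real.Gamma x * Real.exp x * 1 *
        Real.exp ((x - 1 / 2) * Real.eulerMascheroniConstant) * (√π * √2)⁻¹)) := by
  refine ((((Real.GammaSeq_tendsto_Gamma x).mul (Real.tendsto_one_add_div_pow_exp x)).mul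
    ?_).mul ?_).mul ?_
  · have := (tendsto_const_div_atTop_nhds_zero_nat x).const_add 1
    simpa using this
  · exact (Real.continuous_exp.tendsto _).comp (Real.tendsto_harmonic_sub_log.const_mul _)
  · exact (Stirling.tendsto_stirlingSeq_sqrt_pi.mul_const _).inv₀ (by positivity)

/-- The functional equation of the Barnes function. -/
theorem barnesG_add_one_eq {x : ℝ} (hx : 1 ≤ x) :
    barnesG (x + 1) = Real.Gamma x * barnesG x := by
  have hx0 : 0 < x := by linarith
  have h1 := tendsto_prod_barnesFactor hx0.le
  have h2 := tendsto_prod_barnesFactor (z := x - 1) (by linarith)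
  rw [sub_add_cancel] at h2
  have h3 := (h2.mul (tendsto_barnes_ratio x)).const_mul
    (barnesPrefactor x / barnesPrefactor (x - 1))
  have h4 := tendsto_nhds_unique (h1.congr' ?_) h3
  · rw [h4]
    have h5 : barnesPrefactor x / barnesPrefactor (x - 1) = (√π * √2) * (Real.exp x)⁻¹ *
        (Real.exp ((x - 1 / 2) * Real.eulerMascheroniConstant))⁻¹ := by
      rw [div_eq_iff (barnesPrefactor_pos _).ne', barnesPrefactor, barnesPrefactor,
        show x / 2 = (1 / 2 : ℝ) + (x - 1) / 2 by ring, Real.rpow_add (by positivity),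
        ← Real.sqrt_eq_rpow, Real.sqrt_mul (by norm_num), ← Real.exp_neg, ← Real.exp_neg,
        show -(x + x ^ 2 * (1 + Real.eulerMascheroniConstant)) / 2 =
          -x + (-((x - 1 / 2) * Real.eulerMascheroniConstant) +
          (-(x - 1 + (x - 1) ^ 2 * (1 + Real.eulerMascheroniConstant)) / 2)) by ring,
        Real.exp_add, Real.exp_add]
      ring
    rw [h5]
    field_simp
  · filter_upwards [eventually_ne_atTop 0] with n hn
    rw [prod_barnesFactor_eq hx0 hn]
    have := (barnesPrefactor_pos (x - 1)).ne'
    field_simp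

theorem barnesG_add_natCast {x : ℝ} (hx : 1 ≤ x) (n : ℕ) :
    barnesG (x + n) = (∏ i ∈ Finset.range n, Real.Gamma (x + i)) * barnesG x := by
  induction n with
  | zero => simp
  | succ n ih =>
    rw [Finset.prod_range_succ, Nat.cast_succ, ← add_assoc,
      barnesG_add_one_eq (by have : (0 : ℝ) ≤ n := n.cast_nonneg; linarith), ih]
    ring

/-- The functional equation, iterated `N + 1` times, turns each Barnes quotient into a product of
Gamma values, and `G(N+2)` into the product of factorials. -/
theorem explicitValue_eq {g d : ℝ} (hg : 0 ≤ g) (hd : 0 ≤ d) (N j k : ℕ) :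
    explicitValue N j k (g + d) d =
      (∏ r ∈ Finset.range (N + 1), (r.factorial * Real.Gamma (g + d + r + 1) /
        (Real.Gamma (g + r + 1) * Real.Gamma (d + r + 1)))) *
      (Real.Gamma (g + j + 1) / Real.Gamma (j + 1)) *
      (Real.Gamma (d + k + 1) / Real.Gamma (k + 1)) *
      ∑ r ∈ Finset.Icc (max j k) N, Real.Gamma (r + 1) / Real.Gamma (g + d + r + 1) *
        Ring.choose (g + r - k - 1) (r - k) * Ring.choose (d + r - j - 1) (r - j) := by
  have key : ∀ {x : ℝ}, 0 ≤ x → barnesG (x + N + 2) =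
      (∏ r ∈ Finset.range (N + 1), Real.Gamma (x + r + 1)) * barnesG (x + 1) := by
    intro x hx
    rw [show x + N + 2 = (x + 1) + (N + 1 : ℕ) by push_cast; ring,
      barnesG_add_natCast (by linarith)]
    simp only [add_right_comm]
  have hpos : ∀ {x : ℝ}, 0 ≤ x → barnesG (x + 1) ≠ 0 := fun hx => (barnesG_pos (by linarith)).ne'
  have h0 := key le_rfl
  simp only [zero_add, barnesG_one, mul_one, Real.Gamma_nat_eq_factorial] at h0
  rw [explicitValue, add_sub_cancel_right, key hg, key hd, key (add_nonneg hg hd), h0]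
  simp only [Finset.prod_div_distrib, Finset.prod_mul_distrib]
  congr 3
  have h1 := hpos hg
  have h2 := hpos hd
  have h3 := hpos (add_nonneg hg hd)
  have h4 : ∏ r ∈ Finset.range (N + 1), Real.Gamma (g + r + 1) ≠ 0 :=
    Finset.prod_ne_zero_iff.2 fun r _ => (Real.Gamma_pos_of_pos (by positivity)).ne'
  have h5 : ∏ r ∈ Finset.range (N + 1), Real.Gamma (d + r + 1) ≠ 0 :=
    Finset.prod_ne_zero_iff.2 fun r _ => (Real.Gamma_pos_of_pos (by positivity)).ne'
  field_simp

end Barnes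

/-! ### The Fourier coefficients of the pure Fisher–Hartwig symbol -/

section FisherHartwig

open Filter Topology MeasureTheory

/-- The weight `e^{iθ(a-b)/2} (2 cos (θ/2))^{a+b}`. -/
noncomputable def fhWeight (a b θ : ℝ) : ℂ :=
  Complex.exp (((a - b) / 2 * θ : ℝ) * Complex.I) * (((2 * Real.cos (θ / 2)) ^ (a + b) : ℝ) : ℂ)

/-- The integral of the weight over the circle. -/
noncomputable def fhIntegral (a b : ℝ) : ℂ := ∫ θ in (-π)..π, fhWeight a b θ

theorem two_cos_half_nonneg {θ : ℝ} (h : θ ∈ Set.Icc (-π) π) : 0 ≤ 2 * Real.cos (θ / 2) :=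
  mul_nonneg (by norm_num) (Real.cos_nonneg_of_mem_Icc ⟨by linarith [h.1], by linarith [h.2]⟩)

theorem two_cos_half_pos {θ : ℝ} (h : θ ∈ Set.Ioo (-π) π) : 0 < 2 * Real.cos (θ / 2) :=
  mul_pos (by norm_num) (Real.cos_pos_of_mem_Ioo ⟨by linarith [h.1], by linarith [h.2]⟩)

theorem continuous_fhWeight {a b : ℝ} (h : 0 ≤ a + b) : Continuous (fhWeight a b) := by
  unfold fhWeight
  refine Continuous.mul (by fun_prop) (Complex.continuous_ofReal.comp ?_)
  exact Continuous.rpow_const (by fun_prop) fun _ => Or.inr h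

/-- With `z = e^{iθ}` the weight is `(1+z)^a (1+1/z)^b`, and `1/(1+z) + 1/(1+1/z) = 1`. The
half-angle form also covers `z = -1`. -/
theorem fhWeight_eq_add {a b θ : ℝ} (h : 1 ≤ a + b) (hθ : θ ∈ Set.Icc (-π) π) :
    fhWeight a b θ = fhWeight (a - 1) b θ + fhWeight a (b - 1) θ := by
  unfold fhWeight
  have h1 : (2 * Real.cos (θ / 2)) ^ (a + b) =
      (2 * Real.cos (θ / 2)) ^ (a + b - 1) * (2 * Real.cos (θ / 2)) := by
    rw [← Real.rpow_add_one' (two_cos_half_nonneg hθ) (by linarith), sub_add_cancel]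
  have h2 : ((2 * Real.cos (θ / 2) : ℝ) : ℂ) =
      Complex.exp ((θ / 2 : ℝ) * Complex.I) + Complex.exp (-(θ / 2 : ℝ) * Complex.I) := by
    rw [Complex.ofReal_mul, Complex.ofReal_cos, Complex.ofReal_ofNat, Complex.two_cos]
  have h3 : (((2 * Real.cos (θ / 2)) ^ (a + b) : ℝ) : ℂ) =
      (((2 * Real.cos (θ / 2)) ^ (a + b - 1) : ℝ) : ℂ) *
        (Complex.exp ((θ / 2 : ℝ) * Complex.I) + Complex.exp (-(θ / 2 : ℝ) * Complex.I)) := by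
    rw [h1, Complex.ofReal_mul, h2]
  rw [h3, show a - 1 + b = a + b - 1 by ring,
    show a + (b - 1) = a + b - 1 by ring,
    show ((((a - 1 - b) / 2 * θ : ℝ) : ℂ) * Complex.I) =
      ((a - b) / 2 * θ : ℝ) * Complex.I + -(θ / 2 : ℝ) * Complex.I by push_cast; ring,
    show ((((a - (b - 1)) / 2 * θ : ℝ) : ℂ) * Complex.I) =
      ((a - b) / 2 * θ : ℝ) * Complex.I + (θ / 2 : ℝ) * Complex.I by push_cast; ring,
    Complex.exp_add, Complex.exp_add]
  ring

theorem fhIntegral_eq_add {a b : ℝ} (h : 1 ≤ a + b) :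
    fhIntegral a b = fhIntegral (a - 1) b + fhIntegral a (b - 1) := by
  unfold fhIntegral
  rw [← intervalIntegral.integral_add]
  · refine intervalIntegral.integral_congr fun θ hθ => ?_
    rw [Set.uIcc_of_le (by linarith [Real.pi_pos])] at hθ
    exact fhWeight_eq_add h hθ
  · exact (continuous_fhWeight (by linarith)).intervalIntegrable _ _
  · exact (continuous_fhWeight (by linarith)).intervalIntegrable _ _

theorem hasDerivAt_fhWeight {a b θ : ℝ} (hθ : θ ∈ Set.Ioo (-π) π) :
    HasDerivAt (fhWeight a b)
      (Complex.I * (a * fhWeight a (b - 1) θ - b * fhWeight (a - 1) b θ)) θ := by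
  have hc := two_cos_half_pos hθ
  have h1 : HasDerivAt (fun θ : ℝ => Complex.exp (((a - b) / 2 * θ : ℝ) * Complex.I))
      (Complex.exp (((a - b) / 2 * θ : ℝ) * Complex.I) * ((((a - b) / 2 * 1 : ℝ) : ℂ) * Complex.I))
      θ := by
    refine HasDerivAt.cexp (HasDerivAt.mul_const ?_ _)
    exact ((hasDerivAt_id θ).const_mul ((a - b) / 2)).ofReal_comp
  have h2 : HasDerivAt (fun θ : ℝ => (2 * Real.cos (θ / 2)) ^ (a + b))
      ((2 * (-Real.sin (θ / 2) * (1 / 2))) * (a + b) * (2 * Real.cos (θ / 2)) ^ (a + b - 1)) θ :=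
    ((((hasDerivAt_id θ).div_const 2).cos).const_mul 2).rpow_const (Or.inl hc.ne')
  refine HasDerivAt.congr_deriv (f := fhWeight a b) (h1.mul h2.ofReal_comp) ?_
  unfold fhWeight
  have h3 : (2 * Real.cos (θ / 2)) ^ (a + b) =
      (2 * Real.cos (θ / 2)) ^ (a + b - 1) * (2 * Real.cos (θ / 2)) := by
    rw [← Real.rpow_add_one hc.ne', sub_add_cancel]
  rw [h3, show a - 1 + b = a + b - 1 by ring,
    show a + (b - 1) = a + b - 1 by ring,
    show ((((a - 1 - b) / 2 * θ : ℝ) : ℂ) * Complex.I) =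
      ((a - b) / 2 * θ : ℝ) * Complex.I + ((-(θ / 2) : ℝ) : ℂ) * Complex.I by push_cast; ring,
    show ((((a - (b - 1)) / 2 * θ : ℝ) : ℂ) * Complex.I) =
      ((a - b) / 2 * θ : ℝ) * Complex.I + (θ / 2 : ℝ) * Complex.I by push_cast; ring,
    Complex.exp_add, Complex.exp_add, Complex.exp_mul_I (θ / 2 : ℝ),
    Complex.exp_mul_I ((-(θ / 2) : ℝ) : ℂ), ← Complex.ofReal_cos, ← Complex.ofReal_sin,
    ← Complex.ofReal_cos, ← Complex.ofReal_sin, Real.cos_neg, Real.sin_neg]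
  generalize (2 * Real.cos (θ / 2)) ^ (a + b - 1) = p
  generalize Real.cos (θ / 2) = c
  generalize Real.sin (θ / 2) = s
  push_cast
  linear_combination (-Complex.exp (((a : ℂ) - b) / 2 * θ * Complex.I) * p * s * (a + b)) *
    Complex.I_sq

/-- Integrate the derivative of the weight over the circle: the boundary terms vanish because `cos
(±π/2) = 0` and `a + b > 0`. -/
theorem fhIntegral_recurrence {a b : ℝ} (h : 1 ≤ a + b) :
    a * fhIntegral a (b - 1) = b * fhIntegral (a - 1) b := by
  have hpi := Real.pi_pos
  have c1 := continuous_fhWeight (a := a) (b := b - 1) (by linarith)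
  have c2 := continuous_fhWeight (a := a - 1) (b := b) (by linarith)
  have h1 := intervalIntegral.integral_eq_sub_of_hasDerivAt_of_le (a := -π) (b := π) (by linarith)
    (continuous_fhWeight (a := a) (b := b) (by linarith)).continuousOn
    (fun θ hθ => hasDerivAt_fhWeight hθ)
    (Continuous.intervalIntegrable (by fun_prop) _ _)
  have h0 : ∀ θ, Real.cos (θ / 2) = 0 → fhWeight a b θ = 0 := by
    intro θ hθ
    rw [fhWeight, hθ, mul_zero, Real.zero_rpow (by linarith), Complex.ofReal_zero, mul_zero]
  rw [h0 π Real.cos_pi_div_two, h0 (-π) (by rw [neg_div, Real.cos_neg, Real.cos_pi_div_two]),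
    intervalIntegral.integral_const_mul, intervalIntegral.integral_sub,
    intervalIntegral.integral_const_mul, intervalIntegral.integral_const_mul, sub_zero] at h1
  · exact sub_eq_zero.1 ((mul_eq_zero.1 h1).resolve_left Complex.I_ne_zero)
  · exact Continuous.intervalIntegrable (by fun_prop) _ _
  · exact Continuous.intervalIntegrable (by fun_prop) _ _

theorem fhIntegral_shift {a b : ℝ} (h : 0 ≤ a + b) :
    ((a + b + 1) * (a + b + 2) : ℝ) * fhIntegral a b =
      ((a + 1) * (b + 1) : ℝ) * fhIntegral (a + 1) (b + 1) := by
  have h1 := fhIntegral_eq_add (a := a) (b := b + 1) (by linarith)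
  have h2 := fhIntegral_recurrence (a := a) (b := b + 1) (by linarith)
  have h3 := fhIntegral_eq_add (a := a + 1) (b := b + 1) (by linarith)
  have h4 := fhIntegral_recurrence (a := a + 1) (b := b + 1) (by linarith)
  simp only [add_sub_cancel_right] at h1 h2 h3 h4
  push_cast at h1 h2 h3 h4 ⊢
  linear_combination (-(a + b + 2 : ℂ)) * ((b + 1 : ℂ) * h1 - h2) -
    (b + 1 : ℂ) * ((a + 1 : ℂ) * h3 + h4)

/-- The value of the normalized integral of the weight. -/
noncomputable def fhGamma (a b : ℝ) : ℝ :=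
  Real.Gamma (a + b + 1) / (Real.Gamma (a + 1) * Real.Gamma (b + 1))

theorem fhGamma_shift {a b : ℝ} (h : 0 ≤ a + b) :
    ((a + b + 1) * (a + b + 2)) * fhGamma a b = ((a + 1) * (b + 1)) * fhGamma (a + 1) (b + 1) := by
  have h1 := Real.inv_Gamma_eq_mul (a + 1)
  have h2 := Real.inv_Gamma_eq_mul (b + 1)
  have h3 := Real.Gamma_add_one (s := a + b + 1) (by linarith)
  have h4 := Real.Gamma_add_one (s := a + b + 1 + 1) (by linarith)
  rw [fhGamma, fhGamma, show a + 1 + (b + 1) + 1 = a + b + 1 + 1 + 1 by ring, div_eq_mul_inv,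
    div_eq_mul_inv, mul_inv, mul_inv, h4, h3, h1, h2]
  ring

theorem fhGamma_pos {a b : ℝ} (ha : 0 ≤ a) (hb : 0 ≤ b) : 0 < fhGamma a b :=
  div_pos (Real.Gamma_pos_of_pos (by linarith))
    (mul_pos (Real.Gamma_pos_of_pos (by linarith)) (Real.Gamma_pos_of_pos (by linarith)))

/-- Integral and Gamma quotient obey the same recurrence under `(a, b) ↦ (a+1, b+1)`. It thus
suffices to compare them as the shift `m` tends to infinity. -/
theorem fhIntegral_mul_fhGamma {a b : ℝ} (h : 0 ≤ a + b) (m : ℕ) :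
    fhIntegral a b * fhGamma (a + m) (b + m) = fhGamma a b * fhIntegral (a + m) (b + m) := by
  induction m generalizing a b with
  | zero => simp [mul_comm]
  | succ m ih =>
    have h1 := ih (a := a + 1) (b := b + 1) (by linarith)
    have h2 := fhIntegral_shift h
    have h3 := congrArg (fun x : ℝ => (x : ℂ)) (fhGamma_shift h)
    have h4 : ((a + b + 1) * (a + b + 2) : ℂ) ≠ 0 := by
      have : ((a + b + 1) * (a + b + 2) : ℝ) ≠ 0 := by positivity
      exact_mod_cast this
    rw [show a + ((m + 1 : ℕ) : ℝ) = a + 1 + m by push_cast; ring,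
      show b + ((m + 1 : ℕ) : ℝ) = b + 1 + m by push_cast; ring]
    push_cast at h2 h3
    refine mul_left_cancel₀ h4 ?_
    linear_combination (fhGamma (a + 1 + m) (b + 1 + m) : ℂ) * h2 -
      fhIntegral (a + 1 + m) (b + 1 + m) * h3 + ((a : ℂ) + 1) * (b + 1) * h1

theorem fhIntegral_zero : fhIntegral 0 0 = 2 * π := by
  simp [fhIntegral, fhWeight]
  ring

theorem fhGamma_zero : fhGamma 0 0 = 1 := by
  simp [fhGamma]

theorem fhIntegral_natCast (m : ℕ) : fhIntegral m m = ((2 * π * fhGamma m m : ℝ) : ℂ) := by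
  have h := fhIntegral_mul_fhGamma (a := 0) (b := 0) (by norm_num) m
  rw [fhIntegral_zero, fhGamma_zero, zero_add, Complex.ofReal_one, one_mul] at h
  rw [← h]
  push_cast
  ring

/-! ### Asymptotics of both sides under large equal shifts. -/

theorem Real.Gamma_add_natCast_add_one {x : ℝ} (hx : 0 < x) (m : ℕ) :
    Real.Gamma (x + m + 1) = (∏ j ∈ Finset.range (m + 1), (x + j)) * Real.Gamma x := by
  induction m with
  | zero => simp [Real.Gamma_add_one hx.ne']
  | succ m ih =>
    rw [Finset.prod_range_succ, Real.Gamma_add_one (by positivity),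
      show x + ((m + 1 : ℕ) : ℝ) = x + m + 1 by push_cast; ring, ih]
    ring

theorem Real.tendsto_Gamma_ratio {x : ℝ} (hx : 0 < x) :
    Tendsto (fun m : ℕ => (m : ℝ) ^ x * m.factorial / Real.Gamma (x + m + 1)) atTop (𝓝 1) := by
  have h0 := (Real.Gamma_pos_of_pos hx).ne'
  have h := (Real.GammaSeq_tendsto_Gamma x).div_const (Real.Gamma x)
  rw [div_self h0] at h
  refine h.congr fun m => ?_
  rw [Real.GammaSeq, Real.Gamma_add_natCast_add_one hx, div_div]

theorem tendsto_fhGamma_ratio {a b : ℝ} (ha : 0 < a) (hb : 0 < b) :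
    Tendsto (fun m : ℕ => fhGamma (a + m) (b + m) / fhGamma m m) atTop (𝓝 (2 ^ (a + b))) := by
  have h1 := Real.tendsto_Gamma_ratio ha
  have h2 := Real.tendsto_Gamma_ratio hb
  -- The numerator contains `Γ(a + b + 2m + 1)`, so its asymptotics is taken along `2m`; the factor
  -- `2^{a+b}` comes from `(2m)^{a+b}`.
  have h3 := (Real.tendsto_Gamma_ratio (add_pos ha hb)).comp
    (tendsto_id.const_mul_atTop' (r := 2) (by norm_num))
  have h4 := (((h1.mul h2).div h3 one_ne_zero).const_mul ((2 : ℝ) ^ (a + b)))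
  simp only [mul_one, div_one] at h4
  refine h4.congr' ?_
  filter_upwards [eventually_ne_atTop 0] with m hm
  have hm0 : (0 : ℝ) < m := Nat.cast_pos.2 (Nat.pos_of_ne_zero hm)
  simp only [Pi.div_apply, Function.comp_apply, id_eq, fhGamma]
  rw [show (m : ℝ) + m + 1 = (2 * m : ℕ) + 1 by push_cast; ring, Real.Gamma_nat_eq_factorial,
    Real.Gamma_nat_eq_factorial, show a + m + (b + m) + 1 = a + b + (2 * m : ℕ) + 1 by
      push_cast; ring, Nat.cast_mul, Real.mul_rpow (by norm_num) hm0.le, Real.rpow_add hm0]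
  have h5 := (Real.Gamma_pos_of_pos (show 0 < a + m + 1 by positivity)).ne'
  have h6 := (Real.Gamma_pos_of_pos (show 0 < b + m + 1 by positivity)).ne'
  have h7 := (Real.Gamma_pos_of_pos (show 0 < a + b + ((2 : ℕ) : ℝ) * m + 1 by positivity)).ne'
  have h8 : (m.factorial : ℝ) ≠ 0 := Nat.cast_ne_zero.2 m.factorial_ne_zero
  have h9 : ((2 * m).factorial : ℝ) ≠ 0 := Nat.cast_ne_zero.2 (Nat.factorial_ne_zero _)
  have h10 := (Real.rpow_pos_of_pos hm0 a).ne'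
  have h11 := (Real.rpow_pos_of_pos hm0 b).ne'
  have h12 := (Real.rpow_pos_of_pos (show (0 : ℝ) < (2 : ℕ) by norm_num) (a + b)).ne'
  push_cast at h7 h12 ⊢
  field_simp

theorem fhWeight_add_natCast {a b θ : ℝ} (h : 0 ≤ a + b) (hθ : θ ∈ Set.Icc (-π) π) (m : ℕ) :
    fhWeight (a + m) (b + m) θ = ((2 * Real.cos (θ / 2)) ^ 2) ^ m • fhWeight a b θ := by
  rw [fhWeight, fhWeight, show a + m + (b + m) = a + b + (2 * m : ℕ) by push_cast; ring,
    Real.rpow_add_of_nonneg (two_cos_half_nonneg hθ) h (Nat.cast_nonneg _), Real.rpow_natCast,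
    add_sub_add_right_eq_sub, ← pow_mul, Complex.real_smul,
    Complex.ofReal_mul ((2 * Real.cos (θ / 2)) ^ (a + b))]
  ring

/-- The normalized kernels `(2 cos (θ/2))^{2m}` concentrate at `θ = 0`, the unique maximum on `[-π,
π]`, where the weight equals `2^{a+b}`. -/
theorem tendsto_fhIntegral_ratio {a b : ℝ} (h : 0 ≤ a + b) :
    Tendsto (fun m : ℕ => fhIntegral (a + m) (b + m) / fhIntegral m m) atTop
      (𝓝 ((2 ^ (a + b) : ℝ) : ℂ)) := by
  have hpi := Real.pi_pos
  have hset : ∀ (a b : ℝ) (m : ℕ), 0 ≤ a + b → fhIntegral (a + m) (b + m) =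
      ∫ θ in Set.Icc (-π) π, ((2 * Real.cos (θ / 2)) ^ 2) ^ m • fhWeight a b θ := by
    intro a b m h
    rw [fhIntegral, intervalIntegral.integral_of_le (by linarith), ← integral_Icc_eq_integral_Ioc]
    exact setIntegral_congr_fun measurableSet_Icc fun θ hθ => fhWeight_add_natCast h hθ m
  have key := tendsto_setIntegral_pow_smul_of_unique_maximum_of_isCompact_of_continuousOn
    (μ := volume) (s := Set.Icc (-π) π) (x₀ := (0 : ℝ))
    (c := fun θ => (2 * Real.cos (θ / 2)) ^ 2) (g := fhWeight a b) isCompact_Icc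
    (by fun_prop) ?_ (fun θ _ => sq_nonneg _) (by simp) ?_ (continuous_fhWeight h).continuousOn
  · have h0 : fhWeight a b 0 = ((2 ^ (a + b) : ℝ) : ℂ) := by
      simp [fhWeight]
    rw [h0] at key
    refine key.congr fun m => ?_
    rw [hset a b m h, show (m : ℝ) = 0 + m by ring, hset 0 0 m (by norm_num), Complex.real_smul,
      div_eq_inv_mul]
    congr 1
    rw [Complex.ofReal_inv, ← integral_complex_ofReal]
    congr 1
    refine integral_congr_ae (Eventually.of_forall fun θ => ?_)
    simp [fhWeight]
  · intro θ hθ hne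
    have h1 := two_cos_half_nonneg hθ
    have h2 : Real.cos (θ / 2) < 1 := by
      refine lt_of_le_of_ne (Real.cos_le_one _) fun h => ?_
      have := (Real.cos_eq_one_iff_of_lt_of_lt (by linarith [hθ.1]) (by linarith [hθ.2])).1 h
      exact hne (by linarith)
    simp only [zero_div, Real.cos_zero]
    nlinarith
  · rw [interior_Icc, closure_Ioo (by linarith)]
    exact ⟨by linarith, by linarith⟩

/-- Shift invariance reduces to the limit `m → ∞`. There both ratios tend to `2^{a+b}`, and the
reference value at `(m, m)` is known from `(0, 0)`. -/
theorem fhIntegral_eq_of_pos {a b : ℝ} (ha : 0 < a) (hb : 0 < b) :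
    fhIntegral a b = ((2 * π * fhGamma a b : ℝ) : ℂ) := by
  have h1 := (tendsto_fhIntegral_ratio (add_pos ha hb).le).const_mul (fhGamma a b : ℂ)
  have h2 := ((Complex.continuous_ofReal.tendsto _).comp (tendsto_fhGamma_ratio ha hb)).const_mul
    (fhIntegral a b / (2 * π))
  have h3 : ((2 ^ (a + b) : ℝ) : ℂ) ≠ 0 :=
    Complex.ofReal_ne_zero.2 (Real.rpow_pos_of_pos two_pos _).ne'
  have h4 := tendsto_nhds_unique (h2.congr fun m => ?_) h1
  · have h5 := mul_right_cancel₀ h3 h4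
    rw [div_eq_iff (by simp)] at h5
    rw [h5]
    push_cast
    ring
  · have h6 : ((fhGamma m m : ℝ) : ℂ) ≠ 0 := Complex.ofReal_ne_zero.2
      (fhGamma_pos (Nat.cast_nonneg m) (Nat.cast_nonneg m)).ne'
    have h7 := fhIntegral_mul_fhGamma (add_pos ha hb).le m
    simp only [Function.comp_apply]
    rw [mul_div_assoc', ← h7, fhIntegral_natCast]
    push_cast
    field_simp

/-- The evaluation of the Fourier coefficients of the pure Fisher–Hartwig symbol. -/
theorem fhIntegral_eq {a b : ℝ} (h : 0 ≤ a + b) :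
    fhIntegral a b = ((2 * π * fhGamma a b : ℝ) : ℂ) := by
  -- A large shift makes both parameters positive, so one of them may be negative as long as `a + b
  -- ≥ 0`.
  obtain ⟨m, hm⟩ := exists_nat_gt (max (-a) (-b))
  have ha : 0 < a + m := by linarith [le_max_left (-a) (-b)]
  have hb : 0 < b + m := by linarith [le_max_right (-a) (-b)]
  have h1 := fhIntegral_mul_fhGamma h m
  have h2 : ((fhGamma (a + m) (b + m) : ℝ) : ℂ) ≠ 0 :=
    Complex.ofReal_ne_zero.2 (fhGamma_pos ha.le hb.le).ne'
  rw [fhIntegral_eq_of_pos ha hb] at h1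
  refine mul_right_cancel₀ h2 (h1.trans ?_)
  push_cast
  ring

end FisherHartwig

/-! ### The Andréief identity and the Morris integral -/

section Andreief

open MeasureTheory

/-- Expand both determinants and integrate by Fubini. For each fixed `σ`, the sum over `τ` is the
signed determinant of `M` with rows permuted by `σ`, which is `M.det`; there are `N!` choices of
`σ`. -/
theorem integral_det_mul_det {N : ℕ} (ν : Measure ℝ) [SigmaFinite ν] (f g : Fin N → ℝ → ℂ)
    (hfg : ∀ i j, Integrable (fun t => f i t * g j t) ν) :
    ∫ θ, Matrix.det (Matrix.of fun i j => f j (θ i)) * Matrix.det (Matrix.of fun i j => g j (θ i))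
        ∂(Measure.pi fun _ : Fin N => ν) =
      N.factorial * Matrix.det (Matrix.of fun i j => ∫ t, f i t * g j t ∂ν) := by
  set M : Matrix (Fin N) (Fin N) ℂ := Matrix.of fun i j => ∫ t, f i t * g j t ∂ν with hM
  have h1 : ∀ θ : Fin N → ℝ, Matrix.det (Matrix.of fun i j => f j (θ i)) *
      Matrix.det (Matrix.of fun i j => g j (θ i)) =
      ∑ σ : Equiv.Perm (Fin N), ∑ τ : Equiv.Perm (Fin N),
        (((Equiv.Perm.sign σ : ℤ) : ℂ) * ((Equiv.Perm.sign τ : ℤ) : ℂ)) *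
          ∏ i, (f (σ i) (θ i) * g (τ i) (θ i)) := by
    intro θ
    rw [← Matrix.det_transpose, ← Matrix.det_transpose (Matrix.of fun i j => g j (θ i)),
      Matrix.det_apply', Matrix.det_apply', Finset.sum_mul_sum]
    refine Finset.sum_congr rfl fun σ _ => Finset.sum_congr rfl fun τ _ => ?_
    rw [Finset.prod_mul_distrib]
    simp only [Matrix.transpose_apply, Matrix.of_apply]
    ring
  have hint : ∀ σ τ : Equiv.Perm (Fin N), Integrable (fun θ : Fin N → ℝ =>
      (((Equiv.Perm.sign σ : ℤ) : ℂ) * ((Equiv.Perm.sign τ : ℤ) : ℂ)) *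
          ∏ i, (f (σ i) (θ i) * g (τ i) (θ i))) (Measure.pi fun _ : Fin N => ν) := fun σ τ =>
    (Integrable.fintype_prod (f := fun i t => f (σ i) t * g (τ i) t)
      fun i => hfg (σ i) (τ i)).const_mul _
  simp only [h1]
  rw [integral_finsetSum _ fun σ _ => integrable_finsetSum _ fun τ _ => hint σ τ]
  have h2 : ∀ σ : Equiv.Perm (Fin N), ∫ θ, ∑ τ : Equiv.Perm (Fin N),
        (((Equiv.Perm.sign σ : ℤ) : ℂ) * ((Equiv.Perm.sign τ : ℤ) : ℂ)) *
          ∏ i, (f (σ i) (θ i) * g (τ i) (θ i)) ∂(Measure.pi fun _ : Fin N => ν) = M.det := by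
    intro σ
    rw [integral_finsetSum _ fun τ _ => hint σ τ]
    have h3 : M.det = (Equiv.Perm.sign σ : ℤ) * (M.submatrix σ id).det := by
      rw [Matrix.det_permute, ← mul_assoc, ← Int.cast_mul, Int.units_coe_mul_self, Int.cast_one,
        one_mul]
    rw [h3, ← Matrix.det_transpose, Matrix.det_apply', Finset.mul_sum]
    refine Finset.sum_congr rfl fun τ _ => ?_
    rw [integral_const_mul, mul_assoc,
      integral_fintype_prod_eq_prod (fun i t => f (σ i) t * g (τ i) t)]
    rfl
  rw [Finset.sum_congr rfl fun σ _ => h2 σ, Finset.sum_const, Finset.card_univ,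
    Fintype.card_perm, Fintype.card_fin, nsmul_eq_mul]

theorem one_add_exp_mul_I (θ : ℝ) :
    1 + Complex.exp (θ * Complex.I) =
      Complex.exp ((θ / 2 : ℝ) * Complex.I) * ((2 * Real.cos (θ / 2) : ℝ) : ℂ) := by
  rw [Complex.ofReal_mul, Complex.ofReal_cos, Complex.ofReal_ofNat, Complex.two_cos, mul_add,
    ← Complex.exp_add, ← Complex.exp_add, add_comm]
  congr 1
  · push_cast
    ring_nf
  · rw [show ((θ / 2 : ℝ) : ℂ) * Complex.I + -((θ / 2 : ℝ) : ℂ) * Complex.I = 0 by ring,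
      Complex.exp_zero]

/-- A Fourier mode is absorbed by shifting the parameters, so every Fourier coefficient is again an
`fhIntegral`. -/
theorem fhWeight_sub_intCast (γ δ θ : ℝ) (n : ℤ) :
    fhWeight (γ - n) (δ + n) θ = fhWeight γ δ θ * Complex.exp (-(n * θ) * Complex.I) := by
  rw [fhWeight, fhWeight, show γ - n + (δ + n) = γ + δ by ring, mul_right_comm, ← Complex.exp_add]
  congr 3
  push_cast
  ring

theorem morris_weight_eq {γ δ θ : ℝ} (hθ : θ ∈ Set.Ioo (-π) π) :
    Complex.exp ((θ : ℂ) * Complex.I * ((γ - δ : ℝ) : ℂ) / 2) *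
        ((‖1 + Complex.exp ((θ : ℂ) * Complex.I)‖ ^ (γ + δ) : ℝ) : ℂ) = fhWeight γ δ θ := by
  rw [one_add_exp_mul_I, norm_mul, Complex.norm_exp_ofReal_mul_I, one_mul, Complex.norm_real,
    Real.norm_of_nonneg (two_cos_half_pos hθ).le, fhWeight]
  congr 2
  push_cast
  ring

theorem pureFH_weight_eq (γ δ : ℕ) (θ : ℝ) :
    pureFH γ δ (Circle.exp θ) = fhWeight γ δ θ := by
  rw [pureFH, Circle.coe_exp, ← Complex.exp_neg, ← neg_mul, ← Complex.ofReal_neg,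
    one_add_exp_mul_I, one_add_exp_mul_I, fhWeight, ← Nat.cast_add, Real.rpow_natCast, neg_div,
    Real.cos_neg, mul_pow, mul_pow, ← Complex.exp_nat_mul, ← Complex.exp_nat_mul, pow_add,
    Complex.ofReal_mul ((2 * Real.cos (θ / 2)) ^ γ), Complex.ofReal_pow, Complex.ofReal_pow,
    mul_mul_mul_comm, ← Complex.exp_add]
  congr 2
  push_cast
  ring

theorem fhIntegral_eq_fhCoeff {γ δ : ℝ} (h : 0 ≤ γ + δ) (n : ℤ) :
    fhIntegral (γ - n) (δ + n) = 2 * π * (fhCoeff γ δ n : ℂ) := by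
  rw [fhIntegral_eq (by linarith), fhGamma, fhCoeff, show γ - n + (δ + n) = γ + δ by ring]
  push_cast
  ring

theorem circleCoeff_pureFH (γ δ : ℕ) (n : ℤ) :
    circleCoeff (pureFH γ δ) n = fhCoeff γ δ n := by
  have hpi := Real.pi_pos
  -- `UnitAddCircle` has period 1; starting at `-1/2`, the substitution `θ = 2πx` lands on `(-π,
  -- π)`.
  rw [circleCoeff, fourierCoeff_eq_intervalIntegral _ _ (-(1 / 2))]
  have h1 : ∀ x ∈ Set.uIcc (-(1 / 2) : ℝ) (-(1 / 2) + 1),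
      @fourier 1 (-n) x • pureFH γ δ (AddCircle.toCircle (x : AddCircle (1 : ℝ))) =
        (fun θ => fhWeight (γ - n) (δ + n) θ) (2 * π * x) := by
    intro x _
    rw [AddCircle.toCircle_apply_mk, div_one, pureFH_weight_eq, fourier_coe_apply,
      smul_eq_mul, mul_comm]
    simp only
    rw [fhWeight_sub_intCast]
    congr 2
    push_cast
    ring
  rw [intervalIntegral.integral_congr h1,
    intervalIntegral.integral_comp_mul_left (fun θ => fhWeight (γ - n) (δ + n) θ)
      (by positivity : 2 * π ≠ 0),
    show 2 * π * -(1 / 2) = -π by ring, show 2 * π * (-(1 / 2) + 1) = π by ring]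
  change (1 / 1 : ℝ) • (2 * π)⁻¹ • fhIntegral (γ - n) (δ + n) = _
  rw [fhIntegral_eq_fhCoeff (by positivity)]
  simp only [div_one, one_smul, Complex.real_smul]
  push_cast
  have : (π : ℂ) ≠ 0 := Complex.ofReal_ne_zero.2 hpi.ne'
  field_simp

theorem prod_normSq_sub_eq {N : ℕ} (θ : Fin N → ℝ) :
    ∏ j, ∏ k ∈ Finset.Ioi j, ((‖Complex.exp ((θ j : ℂ) * Complex.I) -
        Complex.exp ((θ k : ℂ) * Complex.I)‖ ^ 2 : ℝ) : ℂ) =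
      (Matrix.vandermonde fun j => Complex.exp ((θ j : ℂ) * Complex.I)).det *
        (Matrix.vandermonde fun j => Complex.exp (-(θ j : ℂ) * Complex.I)).det := by
  rw [Matrix.det_vandermonde, Matrix.det_vandermonde, ← Finset.prod_mul_distrib]
  refine Finset.prod_congr rfl fun j _ => ?_
  rw [← Finset.prod_mul_distrib]
  refine Finset.prod_congr rfl fun k _ => ?_
  have hc : ∀ t : ℝ, (starRingEnd ℂ) (Complex.exp ((t : ℂ) * Complex.I)) =
      Complex.exp (-(t : ℂ) * Complex.I) := by
    intro t
    rw [← Complex.exp_conj]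
    simp
  rw [Complex.ofReal_pow, ← Complex.mul_conj', map_sub, hc, hc]
  ring

theorem morrisIntegral_schur_eq_det_alternant {N : ℕ} {γ δ : ℝ} (h : 0 < γ + δ)
    {la mu : YoungDiagram} (hl : la.colLen 0 ≤ N) (hm : mu.colLen 0 ≤ N) :
    morrisIntegral N γ δ (schur ℂ la N) (schur ℂ mu N) =
      Matrix.det (Matrix.of fun i j : Fin N =>
        (fhCoeff γ δ ((alternantExp mu N j : ℤ) - alternantExp la N i) : ℂ)) := by
  have hpi := Real.pi_pos
  set f : Fin N → ℝ → ℂ := fun i t =>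
    fhWeight γ δ t * Complex.exp ((t : ℂ) * Complex.I) ^ alternantExp la N i with hf
  set g : Fin N → ℝ → ℂ := fun j t => Complex.exp (-(t : ℂ) * Complex.I) ^ alternantExp mu N j
    with hg
  have hW := continuous_fhWeight h.le
  have hfg : ∀ i j, (fun t => f i t * g j t) =
      fhWeight (γ - ((alternantExp mu N j : ℤ) - alternantExp la N i : ℤ))
        (δ + ((alternantExp mu N j : ℤ) - alternantExp la N i : ℤ)) := by
    intro i j
    funext t
    rw [fhWeight_sub_intCast]
    simp only [hf, hg]
    rw [← Complex.exp_nat_mul, ← Complex.exp_nat_mul, mul_assoc, ← Complex.exp_add]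
    congr 2
    push_cast
    ring
  have hint : ∀ i j, Integrable (fun t => f i t * g j t) (volume.restrict (Set.Ioo (-π) π)) := by
    intro i j
    rw [hfg]
    exact ((continuous_fhWeight (by linarith)).integrableOn_Icc).mono_set Set.Ioo_subset_Icc_self
  have hval : ∀ i j, ∫ t in Set.Ioo (-π) π, f i t * g j t =
      2 * π * (fhCoeff γ δ ((alternantExp mu N j : ℤ) - alternantExp la N i) : ℂ) := by
    intro i j
    rw [← fhIntegral_eq_fhCoeff h.le, hfg, fhIntegral,
      intervalIntegral.integral_of_le (by linarith), integral_Ioc_eq_integral_Ioo]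
  have hmeas : volume.restrict (Set.univ.pi fun _ : Fin N => Set.Ioo (-π) π) =
      Measure.pi fun _ : Fin N => (volume : Measure ℝ).restrict (Set.Ioo (-π) π) := by
    rw [volume_pi, Measure.restrict_pi_pi]
  have hset : MeasurableSet (Set.univ.pi fun _ : Fin N => Set.Ioo (-π) π) :=
    MeasurableSet.univ_pi fun _ => measurableSet_Ioo
  rw [morrisIntegral, setIntegral_congr_fun (g := fun θ : Fin N → ℝ =>
    Matrix.det (Matrix.of fun i j => f j (θ i)) * Matrix.det (Matrix.of fun i j => g j (θ i)))
    hset, hmeas, integral_det_mul_det _ f g hint]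
  · have h1 : (Matrix.of fun i j => ∫ t in Set.Ioo (-π) π, f i t * g j t) =
        (2 * π : ℂ) • Matrix.of fun i j : Fin N =>
          (fhCoeff γ δ ((alternantExp mu N j : ℤ) - alternantExp la N i) : ℂ) := by
      ext i j
      rw [Matrix.of_apply, hval, Matrix.smul_apply, Matrix.of_apply, smul_eq_mul]
    rw [h1, Matrix.det_smul, Fintype.card_fin]
    have h2 : (N.factorial : ℂ) ≠ 0 := Nat.cast_ne_zero.2 N.factorial_ne_zero
    have h3 : (2 * π : ℂ) ≠ 0 := mul_ne_zero two_ne_zero (Complex.ofReal_ne_zero.2 hpi.ne')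
    field_simp
  · intro θ hθ
    have hθ' : ∀ j, θ j ∈ Set.Ioo (-π) π := fun j => hθ j (Set.mem_univ j)
    simp only
    rw [Finset.prod_congr rfl fun j _ => morris_weight_eq (hθ' j), prod_normSq_sub_eq]
    have h1 : Matrix.det (Matrix.of fun i j => f j (θ i)) = (∏ j, fhWeight γ δ (θ j)) *
        (skewSchurEval la ⊥ (fun j => Complex.exp ((θ j : ℂ) * Complex.I)) *
          (Matrix.vandermonde fun j => Complex.exp ((θ j : ℂ) * Complex.I)).det) := by
      rw [skewSchurEval_bot_mul_vandermonde _ hl, ← Matrix.det_mul_column]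
      rfl
    have h2 : Matrix.det (Matrix.of fun i j => g j (θ i)) =
        skewSchurEval mu ⊥ (fun j => Complex.exp (-(θ j : ℂ) * Complex.I)) *
          (Matrix.vandermonde fun j => Complex.exp (-(θ j : ℂ) * Complex.I)).det := by
      rw [skewSchurEval_bot_mul_vandermonde _ hm]
    rw [h1, h2, schur, schur, eval_skewSchur, eval_skewSchur]
    ring

/-- The Morris integral with Schur polynomials inserted is a Toeplitz minor. -/
theorem morrisIntegral_schur {N : ℕ} {γ δ : ℝ} (h : 0 < γ + δ)
    {la mu : YoungDiagram} (hl : la.colLen 0 ≤ N) (hm : mu.colLen 0 ≤ N) :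
    morrisIntegral N γ δ (schur ℂ la N) (schur ℂ mu N) =
      Matrix.det (Matrix.of fun j k : Fin N =>
        (fhCoeff γ δ ((j : ℤ) - la.rowLen j - (k : ℤ) + mu.rowLen k) : ℂ)) := by
  -- Alternant exponents are listed in increasing order; reversing rows and columns restores the
  -- order of the parts.
  rw [morrisIntegral_schur_eq_det_alternant h hl hm, ← Matrix.det_submatrix_equiv_self Fin.revPerm]
  congr 1
  ext j k
  simp only [Matrix.submatrix_apply, Matrix.of_apply, alternantExp, Fin.revPerm_apply, Fin.val_rev]
  have hj : N - 1 - (N - ((j : ℕ) + 1)) = j := by omega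
  have hk : N - 1 - (N - ((k : ℕ) + 1)) = k := by omega
  rw [hj, hk]
  congr 2
  have := j.2
  have := k.2
  omega

end Andreief

/-! ### Specialization at ones -/

/-- Both sides are `binom(g+d, d+n)`; out of range, the left-hand side vanishes at a pole of `Γ`. -/
theorem fhCoeff_natCast (g d : ℕ) (n : ℤ) :
    fhCoeff g d n = elemSymm (fun _ : Fin (g + d) => (1 : ℝ)) (d + n) := by
  rw [elemSymm_one, fhCoeff]
  split_ifs with h
  · obtain ⟨m, hm⟩ := Int.eq_ofNat_of_zero_le h
    have hm' : ((d : ℝ) + n) = m := by exact_mod_cast hm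
    have hn : (g : ℝ) - n = ((g + d : ℕ) : ℝ) - m := by
      rw [← hm']
      push_cast
      ring
    rw [hm, Int.toNat_natCast, ← Ring.choose_natCast, choose_eq_Gamma (Nat.cast_nonneg _), hm', hn,
      Real.Gamma_nat_eq_factorial, div_eq_mul_inv, mul_inv, mul_comm (m.factorial : ℝ)⁻¹]
    push_cast
    rfl
  · obtain ⟨m, hm⟩ : ∃ m : ℕ, (d : ℤ) + n + 1 = -m := ⟨(-(d + n + 1)).toNat, by omega⟩
    have hm' : (d : ℝ) + n + 1 = -m := by exact_mod_cast hm
    rw [hm', Real.Gamma_neg_nat_eq_zero, mul_zero, div_zero]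

theorem rowLen_rectPartition (a b i : ℕ) :
    (rectPartition a b).rowLen i = if i < b then a else 0 :=
  eq_of_forall_lt_iff fun j => by
    rw [← YoungDiagram.mem_iff_lt_rowLen, mem_rectPartition]
    split_ifs with h <;> simp [h]

theorem rectPartition_transpose (a b : ℕ) : (rectPartition a b).transpose = rectPartition b a := by
  apply SetLike.ext
  rintro ⟨i, j⟩
  rw [YoungDiagram.mem_transpose, Prod.swap_prod_mk, mem_rectPartition, mem_rectPartition, and_comm]

theorem colLen_rectPartition_le {a b N : ℕ} (h : b ≤ N) : (rectPartition a b).colLen 0 ≤ N :=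
  YoungDiagram.colLen_zero_le_iff.2 fun i hi => by
    rw [rowLen_rectPartition, if_neg (by omega)]

theorem bot_transpose : (⊥ : YoungDiagram).transpose = ⊥ := by
  apply SetLike.ext
  intro c
  simp only [YoungDiagram.mem_transpose, YoungDiagram.notMem_bot]

theorem colLen_addPartition_le {α β : YoungDiagram} {N : ℕ} (hα : α.colLen 0 ≤ N)
    (hβ : β.colLen 0 ≤ N) : (addPartition α β).colLen 0 ≤ N :=
  YoungDiagram.colLen_zero_le_iff.2 fun i hi => by
    rw [rowLen_addPartition, YoungDiagram.colLen_zero_le_iff.1 hα i hi,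
      YoungDiagram.colLen_zero_le_iff.1 hβ i hi]

theorem ofReal_elemSymm {n : ℕ} (m : ℤ) :
    ((elemSymm (fun _ : Fin n => (1 : ℝ)) m : ℝ) : ℂ) = elemSymm (fun _ : Fin n => (1 : ℂ)) m := by
  rw [elemSymm_one, elemSymm_one]
  split_ifs <;> simp

theorem evalOnes_skewSchur_addPartition {R : Type*} [CommRing R] {N d n : ℕ}
    {la mu : YoungDiagram} (hl : la.colLen 0 ≤ N) (hm : mu.colLen 0 ≤ N) :
    evalOnes (skewSchur R (addPartition (rectPartition d N) mu).transpose la.transpose n) =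
      Matrix.det (Matrix.of fun j k : Fin N => elemSymm (fun _ : Fin n => (1 : R))
        (d + ((j : ℤ) - la.rowLen j - (k : ℤ) + mu.rowLen k))) := by
  rw [evalOnes, eval_skewSchur, skewSchurEval_transpose _
    (colLen_addPartition_le (colLen_rectPartition_le le_rfl) hm) hl, ← Matrix.det_transpose]
  congr 1
  ext j k
  rw [Matrix.transpose_apply, Matrix.of_apply, Matrix.of_apply, rowLen_addPartition,
    rowLen_rectPartition, if_pos k.2]
  congr 1
  push_cast
  ring

theorem rectWithRow_eq_transpose {N d j : ℕ} (hj : j ≤ N) :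
    rectWithRow N d j hj = (addPartition (rectPartition d N) (rectPartition 1 j)).transpose := by
  apply SetLike.ext
  rintro ⟨a, b⟩
  rw [YoungDiagram.mem_transpose, Prod.swap_prod_mk, mem_addPartition, rowLen_rectPartition,
    rowLen_rectPartition, rectWithRow, YoungDiagram.mem_ofRowLens]
  simp only [List.length_append, List.length_replicate, List.length_singleton]
  constructor
  · rintro ⟨h1, h2⟩
    rcases lt_or_ge a d with h | h
    · rw [List.getElem_append_left (by simpa using h), List.getElem_replicate] at h2
      rw [if_pos h2]
      omega
    · rw [List.getElem_append_right (by simpa using h), List.getElem_singleton] at h2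
      rw [if_pos (show b < N by omega), if_pos h2]
      omega
  · intro h2
    have h1 : a < d + 1 := by split_ifs at h2 <;> omega
    refine ⟨h1, ?_⟩
    rcases lt_or_ge a d with h | h
    · rw [List.getElem_append_left (by simpa using h), List.getElem_replicate]
      split_ifs at h2 <;> omega
    · rw [List.getElem_append_right (by simpa using h), List.getElem_singleton]
      split_ifs at h2 <;> omega

theorem schur_column {N k : ℕ} : schur ℂ (rectPartition 1 k) N = MvPolynomial.esymm (Fin N) ℂ k := by
  rw [schur, skewSchur_eq_skewSchurEval, ← rectPartition_transpose, ← bot_transpose,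
    skewSchurEval_transpose (N := 1) _ (colLen_rectPartition_le le_rfl)
      (YoungDiagram.colLen_zero_le_iff.2 fun i _ => ?_), Matrix.det_fin_one, Matrix.of_apply,
    rowLen_rectPartition]
  · have h : (⊥ : YoungDiagram).rowLen 0 = 0 := by
      by_contra h
      exact YoungDiagram.notMem_bot _ (YoungDiagram.mem_iff_lt_rowLen.2 (Nat.pos_of_ne_zero h))
    simp only [Fin.val_zero, zero_lt_one, if_true, h, Nat.cast_zero, sub_zero]
    rw [elemSymm_natCast]
    rfl
  · by_contra h
    exact YoungDiagram.notMem_bot _ (YoungDiagram.mem_iff_lt_rowLen.2 (Nat.pos_of_ne_zero h))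

/-- Subtracting the parts of `(1^k)` leaves a gap at `k` among the indices `0, …, N`. The common `+
1` cancels in index differences, so a minor for two columns is a cofactor of the larger Toeplitz
matrix. -/
theorem succAbove_val_eq_sub_rowLen {N k : ℕ} (hk : k < N + 1) (a : Fin N) :
    (((⟨k, hk⟩ : Fin (N + 1)).succAbove a : ℕ) : ℤ) =
      (a : ℤ) - (rectPartition 1 k).rowLen a + 1 := by
  rw [rowLen_rectPartition]
  by_cases h : (a : ℕ) < k
  · rw [Fin.succAbove_of_castSucc_lt ⟨k, hk⟩ a (Fin.lt_def.2 h), if_pos h]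
    simp
  · rw [Fin.succAbove_of_le_castSucc ⟨k, hk⟩ a (Fin.le_def.2 (not_lt.1 h)), if_neg h]
    simp

theorem det_fhCoeff_columns {N j k : ℕ} (hj : j ≤ N) (hk : k ≤ N) {g d : ℝ} (hg : 0 ≤ g)
    (hd : 0 ≤ d) :
    Matrix.det (Matrix.of fun a b : Fin N => fhCoeff g d ((a : ℤ) - (rectPartition 1 k).rowLen a -
      (b : ℤ) + (rectPartition 1 j).rowLen b)) = explicitValue N j k (g + d) d := by
  rw [explicitValue_eq hg hd, ← det_fhMatrix_minor hg hd (Nat.lt_succ_of_le hj)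
    (Nat.lt_succ_of_le hk)]
  congr 1
  ext a b
  rw [Matrix.of_apply, Matrix.of_apply, succAbove_val_eq_sub_rowLen, succAbove_val_eq_sub_rowLen]
  congr 1
  ring

/-! ### The four statements assembled. -/

theorem mainTheorem5 (N : ℕ) (hN : 1 ≤ N) :
    -- the Toeplitz minor is a specialized skew Schur polynomial and a Morris integral
    (∀ (γ δ : ℕ), 1 ≤ γ → 1 ≤ δ → ∀ (la mu : YoungDiagram), la.colLen 0 ≤ N → mu.colLen 0 ≤ N →
      toeplitzMinor N la mu (pureFH γ δ) =
          evalOnes (skewSchur ℂ (addPartition (rectPartition δ N) mu).transpose la.transpose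
            (γ + δ)) ∧
        morrisIntegral N γ δ (schur ℂ la N) (schur ℂ mu N) =
          toeplitzMinor N la mu (pureFH γ δ)) ∧
    -- the Schur polynomial of a column is elementary symmetric
    (∀ k : ℕ, k ≤ N → schur ℂ (rectPartition 1 k) N = MvPolynomial.esymm (Fin N) ℂ k) ∧
    -- the explicit evaluation of the skew Schur polynomial
    (∀ (j k : ℕ) (hj : j ≤ N), k ≤ N → ∀ (d M : ℕ), (d < M ∨ (d ≤ M ∧ j = 0)) →
      evalOnes (skewSchur ℝ (rectWithRow N d j hj) (rectPartition k 1) M) =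
        explicitValue N j k M d) ∧
    -- the explicit evaluation of the Morris integral, for all positive real parameters
    (∀ (j k : ℕ), j ≤ N → k ≤ N → ∀ (γ δ : ℝ), 0 < γ → 0 < δ →
      morrisIntegral N γ δ (MvPolynomial.esymm (Fin N) ℂ k) (MvPolynomial.esymm (Fin N) ℂ j) =
        (explicitValue N j k (γ + δ) δ : ℂ)) := by
  refine ⟨fun γ δ hγ _ la mu hl hm => ?_, fun k _ => schur_column, fun j k hj hk d M hdM => ?_,
    fun j k hj hk γ δ hγ hδ => ?_⟩
  · have hpos : 0 < (γ : ℝ) + δ := by positivity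
    constructor
    · rw [evalOnes_skewSchur_addPartition hl hm, toeplitzMinor]
      simp only [circleCoeff_pureFH, fhCoeff_natCast, ofReal_elemSymm]
    · rw [morrisIntegral_schur hpos hl hm, toeplitzMinor]
      simp only [circleCoeff_pureFH]
  -- The shape is the conjugate of `((d^N) + (1^j)) / (1^k)`, so its value is the minor with integer
  -- parameters `g = M - d` and `d`.
  · obtain ⟨g, rfl⟩ : ∃ g, M = g + d := ⟨M - d, by omega⟩
    rw [rectWithRow_eq_transpose, ← rectPartition_transpose 1 k,
      evalOnes_skewSchur_addPartition (colLen_rectPartition_le hk) (colLen_rectPartition_le hj),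
      Nat.cast_add, ← det_fhCoeff_columns hj hk g.cast_nonneg d.cast_nonneg]
    simp only [fhCoeff_natCast]
  · rw [← schur_column, ← schur_column, morrisIntegral_schur (add_pos hγ hδ)
      (colLen_rectPartition_le hk) (colLen_rectPartition_le hj),
      ← det_fhCoeff_columns hj hk hγ.le hδ.le]
    exact (Complex.ofRealHom.map_det _).symm
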